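/- **Theorem (security of PRAG-II).** PRAG-II is an interactive retrieval protocol between a client, who owns a data set $\mathcal D$ of real embedding vectors and queries $\mathbf q^{(1)},\dots,\mathbf q^{(Q)}$, and an honest-but-curious server. The client encrypts all vectors with the leveled CKKS scheme and uploads them with the public evaluation keys. The server homomorphically computes squared distances (and centroid updates, with a polynomial approximation of $x\mapsto 1/x$). In K-means clustering, in the insertions that build one HNSW graph per cluster, and in query routing (choice of the probed clusters, descent through the HNSW layers, candidate search in the base layer) it sends encrypted distances to the client, who decrypts them and answers only with positions of the nearest candidates, in order. Each query may be mixed with dummy traversals (rate $\rho$, answered at random), traversals are padded to length $\ell_{\max}$, and the encrypted index may be rebuilt with fresh encryptions after every $E$ queries. The view $\mathsf{View}(\mathcal D,\{\mathbf q^{(i)}\})$ of the server consists of the public keys, all uploaded and intermediate ciphertexts, the public sizes, its random choices, the sequence of its accesses to ciphertexts, and the client's answers. The (randomized) leakage $\mathcal L(\mathcal D,\{\mathbf q^{(i)}\})$ consists of $|\mathcal D|$, the dimension $d$, the number $C$ of clusters, the result size $K$, the server's random choices, and the perturbed access pattern, extended by the local orderings that the client reveals (chosen clusters, chosen neighbors,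 with their candidate sets), all computed from a run of the protocol on the plaintexts in exact arithmetic; it contains no plaintexts, scores, keys, or ciphertexts. Let all public parameters (ring degree, bit lengths of the moduli and constants, multiplicative depth, $|\mathcal D|$, $Q$, $C$, number of iterations, HNSW parameters, …) be bounded by a polynomial in the security parameter $\lambda$, and assume that the CKKS scheme with these parameters, evaluation keys being public, is IND-CPA secure. Then there is a probabilistic polynomial-time simulator $\mathcal S$ such that $$\{\mathsf{View}(\mathcal D,\{\mathbf q^{(i)}\})\}_\lambda\ \stackrel{c}{\approx}\ \{\mathcal S(\mathcal L(\mathcal D,\{\mathbf q^{(i)}\}),1^\lambda)\}_\lambda$$ for all families of data sets and queries on which the client's decisions are exact, that is, on which, except with negligible probability, every ordering that the client obtains by decryption is the ordering of the same values computed without noise. Here "probabilistic polynomial time" is non-uniform (for adversaries, distinguishers and the simulator), $\stackrel{c}{\approx}$ means that every such distinguisher has negligible advantage, and one simulator serves all inputs and all distinguishers. -/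

import Mathlib

open scoped BigOperators

noncomputable section

namespace PRAG

/-! ### Arithmetic in `ℤ[X]/(X^N + 1)`, elements given by their coefficients -/

/-- Coefficient vectors of elements of `ℤ[X]/(X^N + 1)`. -/
abbrev RingElt (N : ℕ) := Fin N → ℤ

/-- Multiplication modulo `X^N + 1`. -/
def ringMul {N : ℕ} (a b : RingElt N) : RingElt N := fun t =>
  ∑ i : Fin N, ∑ j : Fin N,
    if (i : ℕ) + j = t then a i * b j
    else if (i : ℕ) + j = t + N then -(a i * b j) else 0

/-- The ring endomorphism `X ↦ X^g` of `ℤ[X]/(X^N + 1)`. -/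
def galois {N : ℕ} (g : ℕ) (a : RingElt N) : RingElt N := fun t =>
  ∑ j : Fin N,
    if ((j : ℕ) * g) % (2 * N) = t then a j
    else if ((j : ℕ) * g) % (2 * N) = t + N then -(a j) else 0

/-- Reduction of all coefficients to `{0, …, q - 1}`. -/
def red {N : ℕ} (q : ℕ) (a : RingElt N) : RingElt N := fun t => a t % (q : ℤ)

/-- Division by `p` with rounding of every coefficient to a nearest integer. -/
def roundDiv {N : ℕ} (p : ℕ) (a : RingElt N) : RingElt N := fun t =>
  (2 * a t + (p : ℤ)) / (2 * (p : ℤ))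

/-! ### The CKKS scheme -/

/-- Parameters of the (leveled) CKKS scheme for one value of the security parameter: `2 ^ logSlots`
plaintext slots, ring degree `N = 2 ^ (logSlots + 1)`, ciphertext moduli `q_l = base * scale ^ l`
for `l ≤ depth`, scaling factor `scale`, auxiliary modulus `special` for key switching, and the
distributions of secret keys, errors and encryption randomness. -/
structure CKKS where
  logSlots : ℕ
  base : ℕ
  base_pos : 0 < base
  scale : ℕ
  scale_pos : 0 < scale
  depth : ℕ
  special : ℕ
  special_pos : 0 < special
  keyDist : PMF (RingElt (2 ^ (logSlots + 1)))
  errDist : PMF (RingElt (2 ^ (logSlots + 1)))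
  encDist : PMF (RingElt (2 ^ (logSlots + 1)))

/-- A ciphertext `(c0, c1)` at level `lvl`, coefficients reduced modulo `q_lvl`. -/
structure Ct (N : ℕ) where
  lvl : ℕ
  c0 : RingElt N
  c1 : RingElt N

instance (N : ℕ) : Inhabited (Ct N) := ⟨⟨0, 0, 0⟩⟩

/-- The public key material held by the server: the encryption key `(b, a)`, the relinearization
key, and the Galois keys for the slot rotations by `2^0, 2^1, …` -/
structure PubKey (N : ℕ) where
  b : RingElt N
  a : RingElt N
  relin : RingElt N × RingElt N
  rot : List (RingElt N × RingElt N)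

instance (N : ℕ) : Inhabited (PubKey N) := ⟨⟨0, 0, (0, 0), []⟩⟩

/-- The slot-wise operations of the scheme. -/
inductive Op
  | add | sub | mul | rot | const

/-- Uniform distribution on coefficient vectors with entries in `{0, …, q - 1}` (for `q ≥ 1`). -/
def uniformElt (N q : ℕ) : PMF (RingElt N) :=
  (PMF.uniformOfFintype (Fin N → Fin (q - 1 + 1))).map fun a t => ((a t : ℕ) : ℤ)

namespace CKKS

variable (K : CKKS)

/-- The ring degree. -/
abbrev N : ℕ := 2 ^ (K.logSlots + 1)

/-- The number of plaintext slots. -/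
abbrev slots : ℕ := 2 ^ K.logSlots

/-- The ciphertext modulus at level `l`. -/
def modulus (l : ℕ) : ℕ := K.base * K.scale ^ l

/-- The `i`-th slot is the evaluation at `exp (i π 5^i / N)`; real part of its `j`-th power. -/
def root (i j : ℕ) : ℝ := Real.cos (Real.pi * (5 : ℝ) ^ i * j / K.N)

/-- Encoding of a vector of real numbers: scaled inverse canonical embedding, rounded. -/
def encode (z : Fin K.slots → ℝ) : RingElt K.N := fun j =>
  round ((K.scale : ℝ) * (2 / (K.N : ℝ)) * ∑ i : Fin K.slots, z i * K.root i j)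

/-- Decoding: (real part of) the canonical embedding, divided by the scaling factor. -/
def decode (m : RingElt K.N) : Fin K.slots → ℝ := fun i =>
  (∑ j : Fin K.N, (m j : ℝ) * K.root i j) / K.scale

/-- Key-switching key from `s'` to `s`, modulo `special * q_depth`. -/
def switchGen (s s' : RingElt K.N) : PMF (RingElt K.N × RingElt K.N) := do
  let a ← uniformElt K.N (K.special * K.modulus K.depth)
  let e ← K.errDist
  return (red (K.special * K.modulus K.depth) (-(ringMul a s) + e + (K.special : ℤ) • s'), a)

/-- Key generation: public key, relinearization and Galois keys, and the secret key. -/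
def keyGen : PMF (PubKey K.N × RingElt K.N) := do
  let s ← K.keyDist
  let a ← uniformElt K.N (K.modulus K.depth)
  let e ← K.errDist
  let relin ← K.switchGen s (ringMul s s)
  let rot ← (List.range K.logSlots).mapM' fun i => K.switchGen s (galois (5 ^ 2 ^ i) s)
  return (⟨red (K.modulus K.depth) (-(ringMul a s) + e), a, relin, rot⟩, s)

/-- Encryption of an encoded message. -/
def enc (pk : PubKey K.N) (m : RingElt K.N) : PMF (Ct K.N) := do
  let v ← K.encDist
  let e0 ← K.errDist
  let e1 ← K.errDist
  return ⟨K.depth, red (K.modulus K.depth) (ringMul v pk.b + m + e0),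
    red (K.modulus K.depth) (ringMul v pk.a + e1)⟩

/-- Decryption to an encoded message (coefficients centered around zero). -/
def dec (s : RingElt K.N) (c : Ct K.N) : RingElt K.N := fun t =>
  Int.bmod ((c.c0 + ringMul c.c1 s) t) (K.modulus c.lvl)

/-- Key switching of one ring element at level `l`. -/
def switch (k : RingElt K.N × RingElt K.N) (l : ℕ) (x : RingElt K.N) :
    RingElt K.N × RingElt K.N :=
  (roundDiv K.special (red (K.special * K.modulus l) (ringMul x k.1)),
   roundDiv K.special (red (K.special * K.modulus l) (ringMul x k.2)))

/-- Rescaling by the scaling factor, which consumes one level (impossible at level `0`). -/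
def rescale (c : Ct K.N) : Ct K.N :=
  if c.lvl = 0 then c else
    ⟨c.lvl - 1, red (K.modulus (c.lvl - 1)) (roundDiv K.scale c.c0),
      red (K.modulus (c.lvl - 1)) (roundDiv K.scale c.c1)⟩

/-- Homomorphic addition; the operands are brought to the lower of their two levels. -/
def homAdd (x y : Ct K.N) : Ct K.N :=
  ⟨min x.lvl y.lvl, red (K.modulus (min x.lvl y.lvl)) (x.c0 + y.c0),
    red (K.modulus (min x.lvl y.lvl)) (x.c1 + y.c1)⟩

/-- Homomorphic subtraction. -/
def homSub (x y : Ct K.N) : Ct K.N :=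
  ⟨min x.lvl y.lvl, red (K.modulus (min x.lvl y.lvl)) (x.c0 - y.c0),
    red (K.modulus (min x.lvl y.lvl)) (x.c1 - y.c1)⟩

/-- Homomorphic multiplication: tensoring, relinearization, rescaling. -/
def homMul (pk : PubKey K.N) (x y : Ct K.N) : Ct K.N :=
  let l := min x.lvl y.lvl
  let w := K.switch pk.relin l (red (K.modulus l) (ringMul x.c1 y.c1))
  K.rescale ⟨l, red (K.modulus l) (ringMul x.c0 y.c0 + w.1),
    red (K.modulus l) (ringMul x.c0 y.c1 + ringMul x.c1 y.c0 + w.2)⟩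

/-- Homomorphic rotation of the slots by `2 ^ b`. -/
def homRot (pk : PubKey K.N) (b : ℕ) (x : Ct K.N) : Ct K.N :=
  let w := K.switch (pk.rot.getD b (0, 0)) x.lvl
    (red (K.modulus x.lvl) (galois (5 ^ 2 ^ b) x.c1))
  ⟨x.lvl, red (K.modulus x.lvl) (galois (5 ^ 2 ^ b) x.c0 + w.1), red (K.modulus x.lvl) w.2⟩

/-- The noiseless encryption of the vector all of whose entries are `z / scale`. -/
def homConst (z : ℤ) : Ct K.N :=
  ⟨K.depth, red (K.modulus K.depth) (fun t => if (t : ℕ) = 0 then z else 0), 0⟩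

/-- Evaluation of an operation on stored ciphertexts; `a` and `b` are addresses, except that `b` is
the exponent of the shift in a rotation, and a constant is given as the difference `a - b`. -/
def evalOp (pk : PubKey K.N) (o : Op) (a b : ℕ) (look : ℕ → Ct K.N) : Ct K.N :=
  match o with
  | .add => K.homAdd (look a) (look b)
  | .sub => K.homSub (look a) (look b)
  | .mul => K.homMul pk (look a) (look b)
  | .rot => K.homRot pk b (look a)
  | .const => K.homConst ((a : ℤ) - (b : ℤ))

/-- The noise-free counterpart of `evalOp` on vectors of real numbers. -/
def exactOp (o : Op) (a b : ℕ) (look : ℕ → Fin K.slots → ℝ) : Fin K.slots → ℝ :=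
  match o with
  | .add => look a + look b
  | .sub => look a - look b
  | .mul => look a * look b
  | .rot => fun i => look a ⟨((i : ℕ) + 2 ^ b) % 2 ^ K.logSlots, Nat.mod_lt _ (by positivity)⟩
  | .const => fun _ => ((a : ℝ) - (b : ℝ)) / K.scale

end CKKS

/-- The natural numbers that make up a ring element with nonnegative coefficients. -/
def codeElt {N : ℕ} (a : RingElt N) : List ℕ := List.ofFn fun t => (a t).toNat

/-- A ciphertext as a list of natural numbers. -/
def codeCt {N : ℕ} (c : Ct N) : List ℕ := c.lvl :: (codeElt c.c0 ++ codeElt c.c1)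

/-- The public key material as a list of natural numbers. -/
def codeKey {N : ℕ} (k : PubKey N) : List ℕ :=
  codeElt k.b ++ codeElt k.a ++ codeElt k.relin.1 ++ codeElt k.relin.2 ++
    k.rot.flatMap fun w => codeElt w.1 ++ codeElt w.2

/-! ### Probabilistic polynomial time

Non-uniform probabilistic polynomial time: for every value of the security parameter a program of
polynomial size for a random access machine with coin flips and indirect addressing. Ciphertexts
are kept in registers of their own, can be read number by number, and the public algorithms of the
encryption scheme are available as instructions. -/

/-- Memory of the machine. -/
structure Mem (N : ℕ) where
  reg : ℕ → ℕ
  ct : ℕ → Ct N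
  key : PubKey N

/-- Instructions; `d` is the target. The instructions `load`, `store` and all those on ciphertexts
address indirectly, through the contents of number registers. -/
inductive Instr
  | const (d n : ℕ)
  | add (d a b : ℕ)
  | sub (d a b : ℕ)
  | half (d a : ℕ)
  | load (d a : ℕ)
  | store (d a : ℕ)
  | flip (d : ℕ)
  | readKey (d i : ℕ)
  | readCt (d c i : ℕ)
  | move (d c : ℕ)
  | keygen
  | enc (d m : ℕ)
  | eval (o : Op) (d a b : ℕ)

/-- Programs are run from the first instruction to the last. -/
abbrev Prog := List Instr

/-- Unit cost, except that writing a constant costs its length in binary. -/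
def Instr.cost : Instr → ℕ
  | .const _ n => 1 + Nat.size n
  | _ => 1

/-- Size, and therefore running time, of a program. -/
def cost (A : Prog) : ℕ := (A.map Instr.cost).sum

/-- The encoded message whose coefficients are in consecutive number registers. -/
def Mem.message {N : ℕ} (m : Mem N) (start : ℕ) : RingElt N := fun t => (m.reg (start + t) : ℤ)

/-- Write to a number register. -/
def Mem.setReg {N : ℕ} (m : Mem N) (d x : ℕ) : Mem N :=
  { m with reg := Function.update m.reg d x }

/-- Write to a ciphertext register. -/
def Mem.setCt {N : ℕ} (m : Mem N) (d : ℕ) (c : Ct N) : Mem N :=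
  { m with ct := Function.update m.ct d c }

/-- Effect of one instruction. -/
def step (K : CKKS) (m : Mem K.N) : Instr → PMF (Mem K.N)
  | .const d n => PMF.pure (m.setReg d n)
  | .add d a b => PMF.pure (m.setReg d (m.reg a + m.reg b))
  | .sub d a b => PMF.pure (m.setReg d (m.reg a - m.reg b))
  | .half d a => PMF.pure (m.setReg d (m.reg a / 2))
  | .load d a => PMF.pure (m.setReg d (m.reg (m.reg a)))
  | .store d a => PMF.pure (m.setReg (m.reg d) (m.reg a))
  | .flip d => (PMF.uniformOfFintype (Fin 2)).map fun r => m.setReg d r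
  | .readKey d i => PMF.pure (m.setReg d ((codeKey m.key).getD (m.reg i) 0))
  | .readCt d c i => PMF.pure (m.setReg d ((codeCt (m.ct (m.reg c))).getD (m.reg i) 0))
  | .move d c => PMF.pure (m.setCt (m.reg d) (m.ct (m.reg c)))
  | .keygen => K.keyGen.map fun k => { m with key := k.1 }
  | .enc d a => (K.enc m.key (m.message (m.reg a))).map fun c => m.setCt (m.reg d) c
  | .eval o d a b =>
      PMF.pure (m.setCt (m.reg d) (K.evalOp m.key o (m.reg a) (m.reg b) m.ct))

/-- Execution of a program. -/
def exec (K : CKKS) : Prog → Mem K.N → PMF (Mem K.N)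
  | [], m => PMF.pure m
  | i :: A, m => (step K m i).bind (exec K A)

/-- Boundedness by a polynomial in the security parameter. -/
def PolyBounded (f : ℕ → ℕ) : Prop := ∃ p : Polynomial ℕ, ∀ s, f s ≤ p.eval s

/-- Families of programs of polynomial size. -/
def PPT (A : ℕ → Prog) : Prop := PolyBounded fun s => cost (A s)

/-- Negligible functions of the security parameter. -/
def Negligible (f : ℕ → ℝ) : Prop :=
  Asymptotics.SuperpolynomialDecay Filter.atTop (fun s : ℕ => (s : ℝ)) f

/-- The probability that a machine stops with output bit `1` in register `0`. -/
def accepts {N : ℕ} (p : PMF (Mem N)) : ℝ :=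
  ((p.map fun m => decide (m.reg 0 = 1)) true).toReal

/-! ### IND-CPA security -/

/-- The IND-CPA experiment. The adversary `A` gets the public key material and leaves two messages
in the registers `0, …, N - 1` and `N, …, 2N - 1`; the challenge is put into ciphertext register
`0`, and the adversary continues with `B`. -/
def cpaGame (K : CKKS) (A B : Prog) (bit : Bool) : ℝ :=
  accepts <| K.keyGen.bind fun k =>
    (exec K A ⟨fun _ => 0, fun _ => default, k.1⟩).bind fun m =>
      (K.enc k.1 (m.message (if bit then K.N else 0))).bind fun c => exec K B (m.setCt 0 c)

/-- IND-CPA security of a family of CKKS instances. -/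
def INDCPA (K : ℕ → CKKS) : Prop :=
  ∀ A B : ℕ → Prog, PPT A → PPT B →
    Negligible fun s => |cpaGame (K s) (A s) (B s) false - cpaGame (K s) (A s) (B s) true|

/-! ### Interactive protocols between the client and the server -/

/-- Plaintexts of the client. -/
inductive Source
  | data (i : ℕ)
  | query (i : ℕ)

/-- An interactive protocol. Ciphertexts held by the server are referred to by their address, the
number of ciphertexts that the server obtained before.
* `draw visible n k`: a uniform choice from `{0, …, n}`, by the server or (if not visible to the
  server) by the client.
* `fresh src k`: the client encrypts a plaintext and uploads the ciphertext.
* `op o a b k`: the server performs a homomorphic operation.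
* `peek hs m k`: the client decrypts the ciphertexts `hs` and finds the (at most) `m` smallest
  values; the continuation, carried out by the client until it answers, gets their positions in
  increasing order of the values.
* `tell hs r k`: the server has sent the ciphertexts `hs` to the client and gets the answer `r`. -/
inductive Proto (α : Type) : Type
  | done : α → Proto α
  | draw : Bool → (n : ℕ) → (Fin (n + 1) → Proto α) → Proto α
  | fresh : Source → (ℕ → Proto α) → Proto α
  | op : Op → ℕ → ℕ → (ℕ → Proto α) → Proto α
  | peek : List ℕ → ℕ → (List ℕ → Proto α) → Proto α
  | tell : List ℕ → List ℕ → Proto α → Proto α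

/-- Sequential composition. -/
def Proto.bind {α β : Type} : Proto α → (α → Proto β) → Proto β
  | .done a, f => f a
  | .draw v n k, f => .draw v n fun r => (k r).bind f
  | .fresh src k, f => .fresh src fun h => (k h).bind f
  | .op o a b k, f => .op o a b fun h => (k h).bind f
  | .peek hs m k, f => .peek hs m fun r => (k r).bind f
  | .tell hs r k, f => .tell hs r (k.bind f)

instance : Monad Proto where
  pure := .done
  bind := .bind

/-- What the server observes besides the ciphertexts themselves: which ciphertexts it receives,
accesses and sends, its own random choices, and the answers of the client. -/
inductive Event
  | fresh
  | op (o : Op) (a b : ℕ)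
  | draw (r : ℕ)
  | answer (hs r : List ℕ)

/-- The positions of the (at most) `m` smallest values, in increasing order of the values. -/
def smallest (vals : List ℝ) (m : ℕ) : List ℕ := by
  classical
  exact ((List.range vals.length).insertionSort
    fun i j => vals.getD i 0 ≤ vals.getD j 0).take m

/-- A way to carry out protocols: what is stored for a plaintext sent by the client, the effect of
an operation, and the value that the client reads off. -/
structure World (X : Type) where
  fresh : Source → PMF X
  op : Op → ℕ → ℕ → (ℕ → X) → X
  value : X → ℝ
  dflt : X

/-- Contents of an address. -/
def World.look {X : Type} (W : World X) (st : List X) (h : ℕ) : X := st.getD h W.dflt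

/-- What the client finds when it looks at the stored items `hs`. -/
def World.peek {X : Type} (W : World X) (st : List X) (hs : List ℕ) (m : ℕ) : List ℕ :=
  smallest (hs.map fun h => W.value (W.look st h)) m

/-- Run of a protocol: the events that the server observes and the items it has stored in the
end. -/
def run {X : Type} (W : World X) {α : Type} : Proto α → List X → PMF (List Event × List X)
  | .done _, st => PMF.pure ([], st)
  | .draw v n k, st => (PMF.uniformOfFintype (Fin (n + 1))).bind fun r =>
      (run W (k r) st).map fun o => ((if v then [Event.draw r] else []) ++ o.1, o.2)
  | .fresh src k, st => (W.fresh src).bind fun x =>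
      (run W (k st.length) (st ++ [x])).map fun o => (Event.fresh :: o.1, o.2)
  | .op o a b k, st =>
      (run W (k st.length) (st ++ [W.op o a b (W.look st)])).map fun z =>
        (Event.op o a b :: z.1, z.2)
  | .peek hs m k, st => run W (k (W.peek st hs m)) st
  | .tell hs r k, st => (run W k st).map fun o => (Event.answer hs r :: o.1, o.2)

/-- Run of a protocol in two worlds side by side, with the same random choices; the result is
whether the client always finds the same ordering in both. -/
def agree {X Y : Type} (W : World X) (V : World Y) {α : Type} :
    Proto α → List X → List Y → PMF Bool
  | .done _, _, _ => PMF.pure true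
  | .draw _ n k, st, st2 => (PMF.uniformOfFintype (Fin (n + 1))).bind fun r =>
      agree W V (k r) st st2
  | .fresh src k, st, st2 => (W.fresh src).bind fun x => (V.fresh src).bind fun y =>
      agree W V (k st.length) (st ++ [x]) (st2 ++ [y])
  | .op o a b k, st, st2 =>
      agree W V (k st.length) (st ++ [W.op o a b (W.look st)]) (st2 ++ [V.op o a b (V.look st2)])
  | .peek hs m k, st, st2 => by
      classical
      exact if W.peek st hs m = V.peek st2 hs m then agree W V (k (W.peek st hs m)) st st2
        else PMF.pure false
  | .tell _ _ k, st, st2 => agree W V k st st2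

/-! ### The PRAG-II protocol -/

/-- Public parameters of PRAG-II for one value of the security parameter. -/
structure Params extends CKKS where
  /-- size of the data set -/
  size : ℕ
  /-- embedding dimension -/
  dim : ℕ
  dim_le : dim ≤ 2 ^ logSlots
  /-- number of queries -/
  queries : ℕ
  /-- number of clusters -/
  clusters : ℕ
  /-- number of K-means iterations -/
  iters : ℕ
  /-- coefficients of the polynomial that approximates `x ↦ 1 / x`, in units of `1 / scale` -/
  recip : List ℤ
  /-- HNSW layers are numbered from `0` to `maxLayer` -/
  maxLayer : ℕ
  /-- HNSW degree parameter -/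
  degree : ℕ
  /-- HNSW search depth -/
  searchDepth : ℕ
  /-- number of clusters probed per query -/
  probes : ℕ
  /-- number of results asked for -/
  topK : ℕ
  /-- obfuscation rate: number of dummy traversals per real traversal -/
  rho : ℝ
  /-- every traversal is padded to this number of observable visits -/
  padLength : ℕ
  /-- number of queries between two reconstructions of the encrypted index (`0`: never) -/
  epoch : ℕ

/-- Uniform choice of `m` different members of a list, in random order. -/
def pick (visible : Bool) : ℕ → List ℕ → Proto (List ℕ)
  | 0, _ => pure []
  | _ + 1, [] => pure []
  | m + 1, x :: xs => .draw visible xs.length fun r => do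
      let rest ← pick visible m ((x :: xs).eraseIdx r)
      return (x :: xs).getD r 0 :: rest

/-- A homomorphic operation of the server. -/
def homOp (o : Op) (a b : ℕ) : Proto ℕ := .op o a b .done

/-- Encryption and upload by the client. -/
def upload (src : Source) : Proto ℕ := .fresh src .done

/-- The server sends ciphertexts, the client answers. -/
def tell (hs r : List ℕ) : Proto Unit := .tell hs r (.done ())

/-- The client orders the values of ciphertexts. -/
def peek (hs : List ℕ) (m : ℕ) : Proto (List ℕ) := .peek hs m .done

/-- The server sends encrypted distances and learns the positions of the `m` smallest ones in
increasing order; in a dummy traversal the client answers with a random ordering instead. -/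
def askNearest (real : Bool) (hs : List ℕ) (m : ℕ) : Proto (List ℕ) := do
  let r ← if real then peek hs m else pick false m (List.range hs.length)
  tell hs r
  return r

/-- One HNSW graph: entry point, its layer, and directed links `(layer, from, to)`. -/
structure Graph where
  entry : Option ℕ
  top : ℕ
  links : List (ℕ × ℕ × ℕ)

/-- Neighbors of a node in a layer. -/
def Graph.neighbors (G : Graph) (l u : ℕ) : List ℕ :=
  ((G.links.filter fun e => e.1 = l ∧ e.2.1 = u).map fun e => e.2.2).dedup

/-- The encrypted index: addresses of the encrypted vectors (by identifier) and of the encrypted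
centroids, and one HNSW graph per cluster. -/
structure Index where
  vecs : List ℕ
  cents : List ℕ
  graphs : List Graph

section Protocol

variable (P : Params)

/-- Homomorphic inner product, in every slot. -/
def homIP (a b : ℕ) : Proto ℕ := do
  let p ← homOp .mul a b
  (List.range P.logSlots).foldlM (fun p i => do
    let r ← homOp .rot p i
    homOp .add p r) p

/-- Homomorphic squared Euclidean distance. -/
def homDist (a b : ℕ) : Proto ℕ := do
  let x ← homOp .sub a b
  homIP P x x

/-- Homomorphic division of a sum by a count, by the polynomial approximation of `1 / x`. -/
def homNorm (sum count : ℕ) : Proto ℕ := do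
  let z ← homOp .const 0 0
  let inv ← P.recip.foldrM (fun c acc => do
    let t ← homOp .mul acc count
    let k ← homOp .const c.toNat (-c).toNat
    homOp .add t k) z
  homOp .mul sum inv

/-- Mean of the stored vectors `hs`. -/
def centroid (hs : List ℕ) : Proto ℕ := do
  let z ← homOp .const 0 0
  let one ← homOp .const P.scale 0
  let sum ← hs.foldlM (fun s h => homOp .add s h) z
  let count ← hs.foldlM (fun s _ => homOp .add s one) z
  homNorm P sum count

/-- The client chooses the `m` members of a candidate list that are nearest to the vector at
address `q`. -/
def nearest (real : Bool) (vecs : List ℕ) (q : ℕ) (cands : List ℕ) (m : ℕ) :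
    Proto (List ℕ) := do
  let ds ← cands.mapM' fun v => homDist P q (vecs.getD v 0)
  let r ← askNearest real ds m
  return r.map fun i => cands.getD i 0

/-- One greedy step: the nearest among the current node and its neighbors in layer `l`. -/
def descend (real : Bool) (vecs : List ℕ) (q : ℕ) (G : Graph) (ep l : ℕ) : Proto ℕ := do
  let r ← nearest P real vecs q (ep :: G.neighbors l ep).dedup 1
  return r.headD ep

/-- Greedy search in one layer with a candidate list: `searchDepth` times the candidates are
extended by their neighbors and the client keeps the `degree` nearest ones, in order. -/
def greedy (real : Bool) (vecs : List ℕ) (q : ℕ) (G : Graph) (ep l : ℕ) : Proto (List ℕ) :=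
  (List.range P.searchDepth).foldlM (fun pool _ =>
    nearest P real vecs q (pool ++ pool.flatMap (G.neighbors l)).dedup P.degree) [ep]

/-- The layer of a new node: at least `l + 1` with probability `1 / degree` if at least `l`. -/
def randomLayer : ℕ → Proto ℕ
  | 0 => pure 0
  | l + 1 => .draw true (P.degree - 1) fun r => do
      if r.val = 0 then
        let t ← randomLayer l
        return t + 1
      else
        return 0

/-- Interactive insertion of the vector with identifier `v`. -/
def insert (vecs : List ℕ) (G : Graph) (v : ℕ) : Proto Graph := do
  let layer ← randomLayer P P.maxLayer
  match G.entry with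
  | none => return ⟨some v, layer, []⟩
  | some e =>
    let q := vecs.getD v 0
    let upper := ((List.range (G.top + 1)).filter fun l => layer < l).reverse
    let ep ← upper.foldlM (fun ep l => descend P true vecs q G ep l) e
    let lower := (List.range (min layer G.top + 1)).reverse
    let out ← lower.foldlM (fun (w : List (ℕ × ℕ × ℕ) × ℕ) l => do
      let near ← greedy P true vecs q G w.2 l
      return (w.1 ++ near.flatMap (fun u => [(l, v, u), (l, u, v)]), near.headD w.2)) (G.links, ep)
    return ⟨some (if G.top < layer then v else e), max G.top layer, out.1⟩

/-- One K-means iteration: assignment by the client, update of the centroids by the server. -/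
def kMeansStep (vecs cents : List ℕ) : Proto (List ℕ × List ℕ) := do
  let assign ← vecs.mapM' fun h => do
    let ds ← cents.mapM' fun c => homDist P h c
    let r ← askNearest true ds 1
    return r.headD 0
  let new ← (List.range cents.length).mapM' fun j => do
    let members := ((vecs.zip assign).filter fun w => w.2 = j).map fun w => w.1
    if members = [] then return cents.getD j 0 else centroid P members
  return (assign, new)

/-- Interactive setup: upload, K-means from `clusters` random data vectors, and one HNSW graph per
cluster; in the end the centroids are sent to the client. -/
def setup : Proto Index := do
  let vecs ← (List.range P.size).mapM' fun i => upload (.data i)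
  let init ← pick true P.clusters (List.range P.size)
  let cents ← init.mapM' fun i => upload (.data i)
  let out ← (List.range P.iters).foldlM (fun (w : List ℕ × List ℕ) _ => kMeansStep P vecs w.2)
    (List.replicate P.size 0, cents)
  let graphs ← (List.range out.2.length).mapM' fun j =>
    ((List.range P.size).filter fun i => out.1.getD i 0 = j).foldlM (insert P vecs)
      ⟨none, 0, []⟩
  tell out.2 []
  return ⟨vecs, out.2, graphs⟩

/-- One traversal of an HNSW graph, real or dummy, padded by visits of random neighbors; in the end
the encrypted distances of the best candidates are sent to the client. -/
def traverse (real : Bool) (vecs : List ℕ) (q : ℕ) (G : Graph) : Proto Unit :=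
  match G.entry with
  | none => tell [] []
  | some e => do
    let upper := ((List.range (G.top + 1)).filter fun l => 0 < l).reverse
    let ep ← upper.foldlM (fun ep l => descend P real vecs q G ep l) e
    let pool ← greedy P real vecs q G ep 0
    let _ ← (List.range (P.padLength - (G.top + P.searchDepth))).foldlM (fun u _ => do
      let r ← nearest P false vecs q (G.neighbors 0 u) 1
      return r.headD u) (pool.headD ep)
    let ds ← (pool.take P.topK).mapM' fun v => homDist P q (vecs.getD v 0)
    tell ds []

/-- Interactive retrieval. The client finds the nearest clusters, adds dummy clusters chosen at
random, and answers with all of them in random order; every one of them is traversed. -/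
def retrieve (I : Index) (i : ℕ) : Proto Unit := do
  let q ← upload (.query i)
  tell [] [P.topK]
  let ds ← I.cents.mapM' fun c => homDist P q c
  let best ← peek ds P.probes
  let dummies ← (List.range ⌈P.rho * best.length⌉₊).mapM' fun _ =>
    pick false 1 (List.range I.cents.length)
  let reqs := best.map (fun j => (j, true)) ++ dummies.map (fun j => (j.headD 0, false))
  let order ← pick false reqs.length (List.range reqs.length)
  let mixed := order.map fun t => reqs.getD t (0, false)
  tell ds (mixed.map fun w => w.1)
  mixed.forM fun w => traverse P w.2 I.vecs q (I.graphs.getD w.1 ⟨none, 0, []⟩)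

/-- The whole protocol: setup and all queries, with a new setup after every epoch. -/
def pragII : Proto Unit := do
  let I ← setup P
  let _ ← (List.range P.queries).foldlM (fun I i => do
    let I ← if i ≠ 0 ∧ i % P.epoch = 0 then setup P else pure I
    retrieve P I i
    return I) I

end Protocol

/-! ### View, leakage, and security -/

/-- The client's inputs for one value of the security parameter: the embedding vectors of the
documents and of the queries. -/
structure Input (P : Params) where
  data : Fin P.size → Fin P.dim → ℝ
  query : Fin P.queries → Fin P.dim → ℝ

/-- The slots of a plaintext, unused slots being zero. -/
def Input.vec {P : Params} (x : Input P) (src : Source) : Fin P.slots → ℝ :=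
  let pad : (Fin P.dim → ℝ) → Fin P.slots → ℝ := fun v t =>
    if h : (t : ℕ) < P.dim then v ⟨t, h⟩ else 0
  match src with
  | .data i => if h : i < P.size then pad (x.data ⟨i, h⟩) else 0
  | .query i => if h : i < P.queries then pad (x.query ⟨i, h⟩) else 0

/-- The slot that the client reads. -/
def slotZero (K : CKKS) : Fin K.slots := ⟨0, by positivity⟩

/-- The real world: encryption, homomorphic operations on ciphertexts, decryption by the client. -/
def realWorld {P : Params} (x : Input P) (pk : PubKey P.N) (sk : RingElt P.N) :
    World (Ct P.N) where
  fresh src := P.enc pk (P.encode (x.vec src))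
  op := P.evalOp pk
  value c := P.decode (P.dec sk c) (slotZero P.toCKKS)
  dflt := default

/-- The same computations on plaintexts, in exact arithmetic. -/
def plainWorld {P : Params} (x : Input P) : World (Fin P.slots → ℝ) where
  fresh src := PMF.pure (x.vec src)
  op := P.exactOp
  value v := v (slotZero P.toCKKS)
  dflt := 0

/-- The leakage: sizes, and the (perturbed) access pattern including all answers of the client,
that is, cluster assignments, chosen clusters, chosen neighbors, with the candidates from which
they were chosen. -/
structure Leakage where
  size : ℕ
  dim : ℕ
  clusters : ℕ
  topK : ℕ
  events : List Event

/-- The leakage function. It depends on the plaintexts only, not on keys or ciphertexts; it is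
randomized because the protocol makes random choices. -/
def leakage (P : Params) (x : Input P) : PMF Leakage :=
  (run (plainWorld x) (pragII P) []).map fun o => ⟨P.size, P.dim, P.clusters, P.topK, o.1⟩

/-- Encoding of events by triples of numbers. -/
def Event.words : Event → List ℕ
  | .fresh => [1, 0, 0]
  | .op .add a b => [2, a, b]
  | .op .sub a b => [3, a, b]
  | .op .mul a b => [4, a, b]
  | .op .rot a b => [5, a, b]
  | .op .const a b => [6, a, b]
  | .draw r => [7, r, 0]
  | .answer hs r => [8, hs.length, r.length] ++ hs.flatMap (fun h => [9, h, 0]) ++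
      r.flatMap (fun i => [10, i, 0])

/-- Encoding of the leakage by numbers. -/
def Leakage.words (L : Leakage) : List ℕ :=
  [L.size, L.dim, L.clusters, L.topK] ++ L.events.flatMap Event.words

/-- A view of the server: public key material, all ciphertexts in the order in which the server
obtained them (encrypted vectors, encrypted queries, intermediate results), and the observed
events with the public sizes. -/
structure View (N : ℕ) where
  key : PubKey N
  cts : List (Ct N)
  words : List ℕ

/-- The view of the server in the execution of PRAG-II. -/
def realView (P : Params) (x : Input P) : PMF (View P.N) :=
  P.keyGen.bind fun k =>
    (run (realWorld x k.1 k.2) (pragII P) []).map fun o =>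
      ⟨k.1, o.2, (Leakage.mk P.size P.dim P.clusters P.topK o.1).words⟩

/-- A view as input in the memory of a machine. -/
def View.load {N : ℕ} (v : View N) : Mem N where
  reg
    | 0 => v.words.length
    | 1 => v.cts.length
    | i + 2 => v.words.getD i 0
  ct i := v.cts.getD i default
  key := v.key

/-- A view as output in the memory of a machine. -/
def Mem.toView {N : ℕ} (m : Mem N) : View N where
  key := m.key
  cts := (List.range (m.reg 1)).map m.ct
  words := (List.range (m.reg 0)).map fun i => m.reg (i + 2)

/-- The output of the simulator `S`, which is given the leakage only. -/
def simView (P : Params) (S : Prog) (x : Input P) : PMF (View P.N) :=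
  (leakage P x).bind fun L =>
    (exec P.toCKKS S (View.load ⟨default, [], L.words⟩)).map Mem.toView

/-- The probability that `A` outputs `1` on a random view. -/
def detects (P : Params) (A : Prog) (v : PMF (View P.N)) : ℝ :=
  accepts (v.bind fun w => exec P.toCKKS A w.load)

/-- Exact client decisions: except with negligible probability every ordering that the client finds
by decryption is the ordering of the underlying plaintext values. -/
def ExactOrderings (P : ℕ → Params) (x : ∀ s, Input (P s)) : Prop :=
  Negligible fun s =>
    (((P s).keyGen.bind fun k =>
      agree (realWorld (x s) k.1 k.2) (plainWorld (x s)) (pragII (P s)) [] []) false).toReal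

/-- Semantic confidentiality of PRAG-II for the inputs in the class `good`: there is a simulator in
probabilistic polynomial time that produces, from the leakage alone, a view that no adversary in
probabilistic polynomial time can tell from the real one. One simulator serves all inputs and all
adversaries. -/
def SemanticConfidentiality (P : ℕ → Params) (good : (∀ s, Input (P s)) → Prop) : Prop :=
  ∃ S : ℕ → Prog, PPT S ∧
    ∀ x : ∀ s, Input (P s), good x →
      ∀ A : ℕ → Prog, PPT A →
        Negligible fun s =>
          |detects (P s) (A s) (realView (P s) (x s)) -
            detects (P s) (A s) (simView (P s) (S s) (x s))|

/-- A bound for the public parameters: ring degree, bit lengths of moduli and constants, and the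
numbers that govern the length of the protocol. -/
def Params.complexity (P : Params) : ℕ :=
  P.N + Nat.size (P.special * P.modulus P.depth) + Nat.size P.scale + P.depth +
    P.size + P.queries + P.clusters + P.iters + P.recip.length +
    (P.recip.map fun c => Nat.size c.natAbs).sum + P.maxLayer + P.degree + P.searchDepth +
    P.probes + P.topK + ⌈P.rho⌉₊ + P.padLength

end PRAG

end

/-!
The server learns nothing beyond the leakage because it only ever sees ciphertexts and the control
flow, and the control flow is the leakage. The proof compares three experiments.

* The real view. As long as the client finds the same orderings in the ciphertexts as in the
  plaintexts, the run on ciphertexts has the same control flow as the run on plaintexts. So up to the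
  probability of a disagreement, which is negligible by assumption, the real view arises as follows:
  draw a transcript from the run on plaintexts (`trace`: the observed events, with the plaintext of
  every upload), and then execute its encryptions and homomorphic operations with a fresh key
  (`CKKS.replay`). This is `run_realWorld_near_replay`.
* The replay of the transcript in which all plaintexts are replaced by zero. For a fixed transcript
  the two replays are related by a hybrid argument, which blanks one plaintext after the other
  (`CKKS.acceptance_sub_blank_le`). A distinguisher of neighboring hybrids gives an IND-CPA adversary
  (`CKKS.challengeProg`, `CKKS.guessProg`) in which the transcript is hard-wired; this is possible
  because adversaries are nonuniform, and no randomness of the protocol or real number has to be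
  handled by a machine. It is of polynomial size because all runs of the protocol are short and use
  short numbers (`bounded_pragII`). Since the adversary depends on the transcript, one needs a
  negligible bound for all adversaries of a given polynomial size at once
  (`INDCPA.exists_negligible_bound`).
* The simulated view. The blanked replay uses no plaintext, so it can be computed from the leakage, by
  a straight-line program (`simulator`) that generates a key and goes through the encoded events,
  encrypting zero for every upload. Its output is distributed exactly as the second experiment
  (`CKKS.exec_simulator`).
-/

open scoped BigOperators ENNReal

noncomputable section

namespace PRAG

/-! ### Comparison of the probabilities of an event -/

/-- Two experiments that begin with the same random choice are as close as their continuations are on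
average. -/
lemma bind_apply_le_add {α β γ δ : Type*} (p : PMF α) {f : α → PMF β} {g : α → PMF γ}
    {h : α → PMF δ} {b : β} {c : γ} {d : δ} (H : ∀ a, f a b ≤ g a c + h a d) :
    p.bind f b ≤ p.bind g c + p.bind h d := by
  simp only [PMF.bind_apply]
  rw [← ENNReal.tsum_add]
  refine ENNReal.tsum_le_tsum fun a => ?_
  rw [← mul_add]
  exact mul_le_mul_right (H a) _

lemma bind_apply_le_add_const {α β γ : Type*} (p : PMF α) {f : α → PMF β} {g : α → PMF γ}
    {b : β} {c : γ} (ε : ℝ≥0∞) (H : ∀ a ∈ p.support, f a b ≤ g a c + ε) :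
    p.bind f b ≤ p.bind g c + ε := by
  simp only [PMF.bind_apply]
  calc ∑' a, p a * f a b ≤ ∑' a, (p a * g a c + p a * ε) := by
        refine ENNReal.tsum_le_tsum fun a => ?_
        by_cases ha : p a = 0
        · simp [ha]
        rw [← mul_add]
        exact mul_le_mul_right (H a ((p.mem_support_iff a).2 ha)) _
    _ = ∑' a, p a * g a c + ε := by
        rw [ENNReal.tsum_add, ENNReal.tsum_mul_right, p.tsum_coe, one_mul]

lemma bind_congr_of_support {α β : Type*} (p : PMF α) {f g : α → PMF β}
    (H : ∀ a ∈ p.support, f a = g a) : p.bind f = p.bind g := by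
  ext b
  simp only [PMF.bind_apply]
  refine tsum_congr fun a => ?_
  by_cases ha : p a = 0
  · simp [ha]
  · rw [H a ((p.mem_support_iff a).2 ha)]

lemma abs_toReal_sub_le {x y ε : ℝ≥0∞} (hx : x ≠ ⊤) (hy : y ≠ ⊤) (hε : ε ≠ ⊤)
    (h₁ : x ≤ y + ε) (h₂ : y ≤ x + ε) : |x.toReal - y.toReal| ≤ ε.toReal := by
  have h₃ := ENNReal.toReal_mono (by finiteness) h₁
  have h₄ := ENNReal.toReal_mono (by finiteness) h₂
  rw [ENNReal.toReal_add (by finiteness) hε] at h₃ h₄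
  rw [abs_le]
  constructor <;> linarith

lemma le_add_of_abs_toReal_sub_le {x y : ℝ≥0∞} (hx : x ≠ ⊤) (hy : y ≠ ⊤) {ε : ℝ}
    (h : |x.toReal - y.toReal| ≤ ε) : x ≤ y + ENNReal.ofReal ε := by
  have hε : 0 ≤ ε := (abs_nonneg _).trans h
  rw [← ENNReal.ofReal_toReal hx, ← ENNReal.ofReal_toReal hy, ← ENNReal.ofReal_add (by simp) hε]
  exact ENNReal.ofReal_le_ofReal (by linarith [(abs_le.1 h).2])

/-! ### Transcripts and their replay -/

/-- A transcript: what the server observes, each event together with the encoded plaintext that the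
client encrypts if the event is an upload (the entry is meaningless at other events). -/
abbrev Transcript (N : ℕ) := List (Event × RingElt N)

/-- The transcript with all plaintexts replaced by zero. -/
def Transcript.blank {N : ℕ} (τ : Transcript N) : Transcript N := τ.map fun w => (w.1, 0)

/-- The number of ciphertexts that the server obtains through an event, which is `0` or `1`. -/
def Event.weight : Event → ℕ
  | .fresh => 1
  | .op _ _ _ => 1
  | .draw _ => 0
  | .answer _ _ => 0

/-- The number of ciphertexts that the server obtains through the events of a transcript. -/
def Transcript.weight {N : ℕ} (τ : Transcript N) : ℕ := (τ.map fun w => w.1.weight).sum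

/-- Run of a protocol on plaintexts, in which the uploaded plaintexts are recorded. It has the control
flow of `run (plainWorld x)`, and is deterministic apart from the choices in `draw`. -/
def trace {P : Params} (x : Input P) {α : Type} :
    Proto α → List (Fin P.slots → ℝ) → PMF (Transcript P.N)
  | .done _, _ => PMF.pure []
  | .draw v n k, st => (PMF.uniformOfFintype (Fin (n + 1))).bind fun r =>
      (trace x (k r) st).map fun τ => (if v then [(Event.draw r, 0)] else []) ++ τ
  | .fresh src k, st => (trace x (k st.length) (st ++ [x.vec src])).map fun τ =>
      (Event.fresh, P.encode (x.vec src)) :: τ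
  | .op o a b k, st =>
      (trace x (k st.length) (st ++ [P.exactOp o a b ((plainWorld x).look st)])).map fun τ =>
        (Event.op o a b, 0) :: τ
  | .peek hs m k, st => trace x (k ((plainWorld x).peek st hs m)) st
  | .tell hs r k, st => (trace x k st).map fun τ => (Event.answer hs r, 0) :: τ

/-- The ciphertexts of the server after one event of a transcript. -/
def CKKS.advance (K : CKKS) (pk : PubKey K.N) (w : Event × RingElt K.N) (cts : List (Ct K.N)) :
    PMF (List (Ct K.N)) :=
  match w.1 with
  | .fresh => (K.enc pk w.2).map fun c => cts ++ [c]
  | .op o a b => PMF.pure (cts ++ [K.evalOp pk o a b fun h => cts.getD h default])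
  | .draw _ => PMF.pure cts
  | .answer _ _ => PMF.pure cts

/-- The ciphertexts of the server after the events of a transcript. -/
def CKKS.replay (K : CKKS) (pk : PubKey K.N) :
    Transcript K.N → List (Ct K.N) → PMF (List (Ct K.N))
  | [], cts => PMF.pure cts
  | w :: τ, cts => (K.advance pk w cts).bind (K.replay pk τ)

lemma CKKS.replay_append (K : CKKS) (pk : PubKey K.N) (τ σ : Transcript K.N)
    (cts : List (Ct K.N)) :
    K.replay pk (τ ++ σ) cts = (K.replay pk τ cts).bind (K.replay pk σ) := by
  induction τ generalizing cts with
  | nil => simp [CKKS.replay]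
  | cons w τ ih => simp only [List.cons_append, CKKS.replay, PMF.bind_bind, funext ih]

/-- The leakage is the transcript without the plaintexts. -/
lemma trace_map_fst {P : Params} (x : Input P) {α : Type} (p : Proto α)
    (st : List (Fin P.slots → ℝ)) :
    (trace x p st).map (List.map Prod.fst) = (run (plainWorld x) p st).map Prod.fst := by
  induction p generalizing st with
  | done a => simp [trace, run, PMF.pure_map]
  | draw v n k ih =>
    simp only [trace, run, PMF.map_bind]
    congr 1
    funext r
    have := congrArg (PMF.map fun l => (if v then [Event.draw r] else []) ++ l) (ih r st)
    simp only [PMF.map_comp] at this ⊢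
    convert this using 2
    · funext τ
      cases v <;> simp
    · rfl
  | fresh src k ih =>
    simp only [trace, run, plainWorld, PMF.pure_bind]
    have := congrArg (PMF.map fun l => Event.fresh :: l) (ih st.length (st ++ [x.vec src]))
    simp only [PMF.map_comp] at this ⊢
    exact this
  | op o a b k ih =>
    simp only [trace, run]
    have := congrArg (PMF.map fun l => Event.op o a b :: l)
      (ih st.length (st ++ [P.exactOp o a b ((plainWorld x).look st)]))
    simp only [PMF.map_comp] at this ⊢
    exact this
  | peek hs m k ih => exact ih _ st
  | tell hs r k ih =>
    simp only [trace, run]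
    have := congrArg (PMF.map fun l => Event.answer hs r :: l) (ih st)
    simp only [PMF.map_comp] at this ⊢
    exact this

/-- The execution of a protocol on ciphertexts and the replay of the transcript of its execution on
plaintexts can be told apart only if the client once finds different orderings. -/
lemma run_realWorld_near_replay {P : Params} (x : Input P) (pk : PubKey P.N) (sk : RingElt P.N)
    {α : Type} (p : Proto α) (cts : List (Ct P.N)) (st : List (Fin P.slots → ℝ))
    (hlen : cts.length = st.length) (D : List Event × List (Ct P.N) → PMF Bool) :
    (run (realWorld x pk sk) p cts).bind D true ≤
        (trace x p st).bind (fun τ => (P.replay pk τ cts).bind fun c => D (τ.map Prod.fst, c)) true +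
          agree (realWorld x pk sk) (plainWorld x) p cts st false ∧
      (trace x p st).bind (fun τ => (P.replay pk τ cts).bind fun c => D (τ.map Prod.fst, c)) true ≤
        (run (realWorld x pk sk) p cts).bind D true +
          agree (realWorld x pk sk) (plainWorld x) p cts st false := by
  induction p generalizing cts st D with
  | done a =>
    simp [run, trace, agree, CKKS.replay]
  | draw v n k ih =>
    have key : ∀ r, _ := fun r =>
      ih r cts st hlen (fun o => D ((if v then [Event.draw r] else []) ++ o.1, o.2))
    simp only [run, trace, agree, PMF.bind_bind, PMF.bind_map, Function.comp_def]
    have hτ : ∀ (r : Fin (n + 1)) (τ : Transcript P.N),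
        ((P.replay pk ((if v = true then [(Event.draw r, (0 : RingElt P.N))] else []) ++ τ) cts).bind
          fun c => D (((if v = true then [(Event.draw r, (0 : RingElt P.N))] else []) ++ τ).map
            Prod.fst, c)) =
        (P.replay pk τ cts).bind fun c =>
          D ((if v then [Event.draw r] else []) ++ τ.map Prod.fst, c) := by
      intro r τ
      cases v <;> simp [CKKS.replay, CKKS.advance]
    simp only [hτ]
    exact ⟨bind_apply_le_add _ fun r => (key r).1, bind_apply_le_add _ fun r => (key r).2⟩
  | fresh src k ih =>
    have key : ∀ c : Ct P.N, _ := fun c =>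
      ih st.length (cts ++ [c]) (st ++ [x.vec src]) (by simp [hlen])
        (fun o => D (Event.fresh :: o.1, o.2))
    have e : (plainWorld x).fresh src = PMF.pure (x.vec src) := rfl
    have e' : (realWorld x pk sk).fresh src = P.enc pk (P.encode (x.vec src)) := rfl
    simp only [run, trace, agree, PMF.bind_bind, PMF.bind_map, Function.comp_def, CKKS.replay,
      CKKS.advance, e, e', PMF.pure_bind, List.map_cons, hlen]
    rw [PMF.bind_comm (trace _ _ _)]
    exact ⟨bind_apply_le_add _ fun r => (key r).1, bind_apply_le_add _ fun r => (key r).2⟩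
  | op o a b k ih =>
    have key := ih st.length
      (cts ++ [(realWorld x pk sk).op o a b ((realWorld x pk sk).look cts)])
      (st ++ [(plainWorld x).op o a b ((plainWorld x).look st)]) (by simp [hlen])
      (fun z => D (Event.op o a b :: z.1, z.2))
    simp only [run, trace, agree, PMF.bind_map, Function.comp_def, CKKS.replay,
      CKKS.advance, PMF.pure_bind, List.map_cons, hlen]
    exact key
  | peek hs m k ih =>
    simp only [run, trace, agree]
    split_ifs with h
    · rw [← h]
      exact ih _ cts st hlen D
    · have h1 : ∀ q : PMF Bool, q true ≤ 1 := fun q => q.coe_le_one _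
      simp only [PMF.pure_apply, if_true]
      exact ⟨(h1 _).trans le_add_self, (h1 _).trans le_add_self⟩
  | tell hs r k ih =>
    have key := ih cts st hlen (fun z => D (Event.answer hs r :: z.1, z.2))
    simp only [run, trace, agree, PMF.bind_map, Function.comp_def, CKKS.replay,
      CKKS.advance, PMF.pure_bind, List.map_cons]
    exact key

/-! ### Execution and cost of programs -/

lemma exec_append (K : CKKS) (A B : Prog) (m : Mem K.N) :
    exec K (A ++ B) m = (exec K A m).bind (exec K B) := by
  induction A generalizing m with
  | nil => simp [exec]
  | cons i A ih => simp only [List.cons_append, exec, PMF.bind_bind, funext ih]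

@[simp] lemma cost_nil : cost [] = 0 := rfl

@[simp] lemma cost_cons (i : Instr) (A : Prog) : cost (i :: A) = i.cost + cost A := by
  simp [cost]

@[simp] lemma cost_append (A B : Prog) : cost (A ++ B) = cost A + cost B := by
  simp [cost]

/-- Write constants to consecutive number registers. -/
def setRegs : ℕ → List ℕ → Prog
  | _, [] => []
  | k, v :: l => .const k v :: setRegs (k + 1) l

lemma exec_setRegs (K : CKKS) (k : ℕ) (l : List ℕ) (m : Mem K.N) :
    exec K (setRegs k l) m = PMF.pure
      ⟨fun i => if k ≤ i ∧ i < k + l.length then l.getD (i - k) 0 else m.reg i, m.ct, m.key⟩ := by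
  induction l generalizing k m with
  | nil =>
    simp only [setRegs, exec, List.length_nil, add_zero]
    congr 1
    cases m
    simp only [Mem.mk.injEq, and_true]
    funext i
    rw [if_neg (by omega)]
  | cons v l ih =>
    simp only [setRegs, exec, step, PMF.pure_bind, ih]
    congr 1
    simp only [Mem.setReg, Mem.mk.injEq, and_true, List.length_cons]
    funext i
    by_cases h1 : i = k
    · subst h1
      simp
    · by_cases h2 : k ≤ i ∧ i < k + (l.length + 1)
      · obtain ⟨j, rfl⟩ : ∃ j, i = k + 1 + j := ⟨i - (k + 1), by omega⟩
        rw [if_pos (by omega), if_pos (by omega)]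
        have e : k + 1 + j - k = j + 1 := by omega
        simp [e]
      · rw [if_neg (by omega), if_neg h2, Function.update_of_ne h1]

lemma cost_setRegs_le (k : ℕ) (l : List ℕ) (w : ℕ) (h : ∀ v ∈ l, Nat.size v ≤ w) :
    cost (setRegs k l) ≤ l.length * (1 + w) := by
  induction l generalizing k with
  | nil => simp [setRegs]
  | cons v l ih =>
    have h1 := ih (k + 1) fun u hu => h u (List.mem_cons_of_mem _ hu)
    have h2 := h v (by simp)
    simp only [setRegs, cost_cons, Instr.cost, List.length_cons, add_mul, one_mul]
    omega

lemma size_le_self (n : ℕ) : Nat.size n ≤ n :=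
  Nat.size_le.2 n.lt_two_pow_self

/-! ### Programs that replay a fixed transcript -/

namespace CKKS

variable (K : CKKS)

lemma modulus_pos (l : ℕ) : 0 < K.modulus l :=
  Nat.mul_pos K.base_pos (pow_pos K.scale_pos l)

/-- The least nonnegative representatives of the coefficients of a message. -/
def residues (m : RingElt K.N) : List ℕ := List.ofFn fun t => (m t % K.modulus K.depth).toNat

/-- Only the residues of a message matter for its encryption. -/
lemma enc_message (pk : PubKey K.N) (m : RingElt K.N) (M : Mem K.N) (k : ℕ)
    (h : ∀ t : Fin K.N, M.reg (k + t) = (K.residues m).getD t 0) :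
    K.enc pk (M.message k) = K.enc pk m := by
  have hq : (0 : ℤ) < K.modulus K.depth := by exact_mod_cast K.modulus_pos _
  have e : ∀ t, M.message k t = m t % K.modulus K.depth := by
    intro t
    have : (K.residues m).getD t 0 = (m t % K.modulus K.depth).toNat := by
      simp [residues, List.getD_eq_getElem?_getD]
    rw [Mem.message, h, this, Int.toNat_of_nonneg (Int.emod_nonneg _ hq.ne')]
  unfold enc
  have e2 : ∀ u v : RingElt K.N, red (K.modulus K.depth) (u + M.message k + v) =
      red (K.modulus K.depth) (u + m + v) := by
    intro u v
    funext t
    simp only [red, Pi.add_apply, e]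
    simp [Int.add_emod]
  simp only [e2]

lemma length_residues (m : RingElt K.N) : (K.residues m).length = K.N := by simp [residues]

lemma size_le_of_mem_residues (m : RingElt K.N) {v : ℕ} (hv : v ∈ K.residues m) :
    Nat.size v ≤ Nat.size (K.modulus K.depth) := by
  have hq : (0 : ℤ) < K.modulus K.depth := by exact_mod_cast K.modulus_pos _
  simp only [residues, List.mem_ofFn] at hv
  obtain ⟨t, rfl⟩ := hv
  refine Nat.size_le_size ?_
  have := Int.emod_lt_of_pos (m t) hq
  omega

/-- A program for one event of a transcript, when the server holds `t` ciphertexts before. -/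
def eventProg (w : Event × RingElt K.N) (t : ℕ) : Prog :=
  match w.1 with
  | .fresh => setRegs 0 (K.residues w.2) ++ (setRegs K.N [t, 0] ++ [.enc K.N (K.N + 1)])
  | .op o a b => setRegs 0 [a, b, t] ++ [.eval o 2 0 1]
  | .draw _ => []
  | .answer _ _ => []

/-- A program for all the events of a transcript. -/
def replayProg : Transcript K.N → ℕ → Prog
  | [], _ => []
  | w :: τ, t => K.eventProg w t ++ replayProg τ (t + w.1.weight)

/-- The memory in which exactly the ciphertexts `cts` are stored. -/
def memOf (pk : PubKey K.N) (reg : ℕ → ℕ) (cts : List (Ct K.N)) : Mem K.N :=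
  ⟨reg, fun i => cts.getD i default, pk⟩

/-- Storing one more ciphertext at the first free address. -/
lemma update_getD_length (cts : List (Ct K.N)) (c : Ct K.N) :
    Function.update (fun i => cts.getD i default) cts.length c =
      fun i => (cts ++ [c]).getD i default := by
  funext i
  rcases lt_trichotomy i cts.length with h | h | h
  · simp [Function.update_of_ne h.ne, List.getD_eq_getElem?_getD, List.getElem?_append_left h]
  · subst h
    simp [List.getD_eq_getElem?_getD]
  · rw [Function.update_of_ne h.ne', List.getD_eq_default _ _ h.le,
      List.getD_eq_default _ _ (by simp; omega)]

lemma two_le_N : 2 ≤ K.N := by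
  have := Nat.one_le_two_pow (n := K.logSlots)
  simp only [CKKS.N, pow_succ]
  omega

/-- The program leaves the ciphertexts that the event produces, and number registers that do not
depend on the randomness of the encryption. -/
lemma exec_eventProg (pk : PubKey K.N) (w : Event × RingElt K.N) (t : ℕ) (reg : ℕ → ℕ) (R : ℕ)
    (hR : K.N + 2 ≤ R) (hreg : ∀ i, R ≤ i → reg i = 0) :
    ∃ reg' : ℕ → ℕ, (∀ i, R ≤ i → reg' i = 0) ∧ ∀ cts : List (Ct K.N), cts.length = t →
      exec K (K.eventProg w t) (K.memOf pk reg cts) =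
        (K.advance pk w cts).map (K.memOf pk reg') := by
  obtain ⟨e, m⟩ := w
  have hN := K.two_le_N
  cases e with
  | fresh =>
    refine ⟨fun i => if K.N ≤ i ∧ i < K.N + 2 then [t, 0].getD (i - K.N) 0 else
      if i < K.N then (K.residues m).getD i 0 else reg i, ?_, ?_⟩
    · intro i hi
      simp only
      rw [if_neg (by omega), if_neg (by omega), hreg i hi]
    · rintro cts rfl
      simp only [eventProg, exec_append, exec_setRegs, PMF.pure_bind, exec, step, memOf, advance,
        length_residues, PMF.map_comp, PMF.bind_pure, zero_le, true_and, zero_add, List.length_cons,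
        List.length_nil, Nat.sub_zero]
      rw [K.enc_message pk m]
      · have e : K.N ≤ K.N + 1 ∧ K.N + 1 < K.N + (1 + 1) := by omega
        have e' : K.N ≤ K.N ∧ K.N < K.N + (1 + 1) := by omega
        congr 1
        funext c
        simpa [Mem.setCt, memOf] using K.update_getD_length cts c
      · intro t
        have ht := t.2
        have h1 : ¬ (K.N ≤ (t : ℕ) ∧ (t : ℕ) < K.N + (1 + 1)) := by omega
        have e : K.N ≤ K.N + 1 ∧ K.N + 1 < K.N + (1 + 1) := by omega
        simp only [e, and_self, if_true, Nat.add_sub_cancel_left, List.getD_cons_succ,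
          List.getD_cons_zero, zero_add, h1, if_false, ht]
  | op o a b =>
    refine ⟨fun i => if i < 3 then [a, b, t].getD i 0 else reg i, ?_, ?_⟩
    · intro i hi
      simp only
      rw [if_neg (by omega), hreg i hi]
    · rintro cts rfl
      simp only [eventProg, exec_append, exec_setRegs, PMF.pure_bind, exec, step, memOf, advance,
        PMF.pure_map]
      simpa [Mem.setCt] using congrArg (fun f => PMF.pure (Mem.mk _ f pk))
        (K.update_getD_length cts (K.evalOp pk o a b fun h => cts.getD h default))
  | draw r =>
    exact ⟨reg, hreg, fun cts _ => by simp [eventProg, exec, advance, PMF.pure_map]⟩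
  | answer hs r =>
    exact ⟨reg, hreg, fun cts _ => by simp [eventProg, exec, advance, PMF.pure_map]⟩

lemma length_of_mem_support_advance (pk : PubKey K.N) (w : Event × RingElt K.N)
    (cts c : List (Ct K.N)) (h : c ∈ (K.advance pk w cts).support) :
    c.length = cts.length + w.1.weight := by
  obtain ⟨e, m⟩ := w
  cases e <;> simp [advance] at h <;> simp [Event.weight]
  · obtain ⟨a, -, rfl⟩ := h
    simp
  · simp [h]
  · simp [h]
  · simp [h]

lemma length_of_mem_support_replay (pk : PubKey K.N) (τ : Transcript K.N)
    (cts c : List (Ct K.N)) (h : c ∈ (K.replay pk τ cts).support) :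
    c.length = cts.length + τ.weight := by
  induction τ generalizing cts with
  | nil =>
    simp [replay] at h
    simp [h, Transcript.weight]
  | cons w τ ih =>
    simp only [replay, PMF.mem_support_bind_iff] at h
    obtain ⟨d, hd, hc⟩ := h
    rw [ih d hc, K.length_of_mem_support_advance pk w cts d hd]
    simp [Transcript.weight, add_assoc]

lemma exec_replayProg (pk : PubKey K.N) (τ : Transcript K.N) (t : ℕ) (reg : ℕ → ℕ) (R : ℕ)
    (hR : K.N + 2 ≤ R) (hreg : ∀ i, R ≤ i → reg i = 0) :
    ∃ reg' : ℕ → ℕ, (∀ i, R ≤ i → reg' i = 0) ∧ ∀ cts : List (Ct K.N), cts.length = t →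
      exec K (K.replayProg τ t) (K.memOf pk reg cts) =
        (K.replay pk τ cts).map (K.memOf pk reg') := by
  induction τ generalizing t reg with
  | nil => exact ⟨reg, hreg, fun cts _ => by simp [replayProg, exec, replay, PMF.pure_map]⟩
  | cons w τ ih =>
    obtain ⟨reg₁, h₁, e₁⟩ := K.exec_eventProg pk w t reg R hR hreg
    obtain ⟨reg₂, h₂, e₂⟩ := ih (t + w.1.weight) reg₁ h₁
    refine ⟨reg₂, h₂, ?_⟩
    rintro cts rfl
    simp only [replayProg, exec_append, e₁ cts rfl, replay, PMF.bind_map, PMF.map_bind]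
    refine bind_congr_of_support _ fun c hc => ?_
    exact e₂ c (K.length_of_mem_support_advance pk w cts c hc)

/-! ### The hybrid step -/

/-- The probability that a machine which continues with `B` accepts after the replay of `τ` with a
fresh key; `B` finds the view of the server in its memory. -/
def acceptance (B : Prog) (pub : List Event → List ℕ) (τ : Transcript K.N) : PMF Bool :=
  K.keyGen.bind fun k => (K.replay k.1 τ []).bind fun c =>
    (exec K B (View.load ⟨k.1, c, pub (τ.map Prod.fst)⟩)).map fun m => decide (m.reg 0 = 1)

/-- First part of the adversary: replay, save the ciphertext in register `0`, which the challenge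
overwrites, and prepare the two messages. -/
def challengeProg (σ : Transcript K.N) (m : RingElt K.N) : Prog :=
  K.replayProg σ 0 ++ (setRegs 0 [0, σ.weight] ++ ([.move 1 0] ++
    setRegs 0 (K.residues m ++ K.residues 0)))

/-- Second part of the adversary: exchange the challenge and the saved ciphertext, replay the rest,
and prepare the memory for the distinguisher. -/
def guessProg (t : ℕ) (τ : Transcript K.N) (regs : List ℕ) (D : Prog) : Prog :=
  setRegs 0 [0, t, t + 1, t + 2] ++ ([.move 2 0, .move 0 1, .move 1 2, .move 2 3] ++
    (K.replayProg τ (t + 1) ++ (setRegs 0 regs ++ D)))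

/-- Register `t + 1` serves as a temporary one, where `t` is the number of ciphertexts; afterwards the
default content is restored from register `t + 2`, which is still untouched. -/
lemma swap_challenge (pk : PubKey K.N) (cts : List (Ct K.N)) (c : Ct K.N) (reg : ℕ → ℕ) :
    exec K [.move 2 0, .move 0 1, .move 1 2, .move 2 3]
      ⟨fun i => if i < 4 then [0, cts.length, cts.length + 1, cts.length + 2].getD i 0 else reg i,
        Function.update (Function.update (fun i => cts.getD i default) cts.length
          (cts.getD 0 default)) 0 c, pk⟩ =
      PMF.pure (K.memOf pk
        (fun i => if i < 4 then [0, cts.length, cts.length + 1, cts.length + 2].getD i 0 else reg i)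
        (cts ++ [c])) := by
  simp only [exec, step, PMF.pure_bind, memOf, Mem.setCt]
  congr 1
  simp only [Mem.mk.injEq, true_and, and_true]
  have h1 : cts.getD (cts.length + 1) default = default := List.getD_eq_default _ _ (by omega)
  have h2 : cts.getD (cts.length + 2) default = default := List.getD_eq_default _ _ (by omega)
  rw [← update_getD_length]
  funext i
  rcases Nat.eq_zero_or_pos cts.length with h0 | h0
  · simp only [h0] at h1 h2 ⊢
    by_cases i0 : i = 0
    · subst i0; simp
    by_cases i1 : i = 1
    · subst i1; simp_all
    simp [i0, i1]
  · have h0' : cts.length ≠ 0 := h0.ne'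
    by_cases i0 : i = 0
    · subst i0
      have h3 : (0 : ℕ) ≠ cts.length := h0.ne
      simp [Function.update_of_ne h3, Function.update_of_ne h0']
    by_cases i1 : i = cts.length + 1
    · subst i1; simp_all
    by_cases i2 : i = cts.length
    · subst i2; simp
    simp [i0, i1, i2]

/-- The contents of the number registers that a view with these public words and `n` ciphertexts has
in the memory of a machine, followed by zeros. -/
def viewRegs (words : List ℕ) (n : ℕ) : List ℕ :=
  words.length :: n :: (words ++ List.replicate (2 * K.N + 2) 0)

lemma viewRegs_getD (pk : PubKey K.N) (words : List ℕ) (cts : List (Ct K.N)) (i : ℕ) :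
    (K.viewRegs words cts.length).getD i 0 = (View.load ⟨pk, cts, words⟩).reg i := by
  match i with
  | 0 => rfl
  | 1 => rfl
  | i + 2 =>
    simp only [viewRegs, List.getD_cons_succ, View.load]
    rcases lt_or_ge i words.length with h | h
    · rw [List.getD_append _ _ _ _ h]
    · rw [List.getD_append_right _ _ _ _ h, List.getD_eq_default _ _ h]
      simp [List.getD_eq_getElem?_getD, List.getElem?_replicate]
      split_ifs <;> rfl

/-- After the replay the memory is prepared exactly as for a distinguisher that gets the view. -/
lemma exec_setRegs_viewRegs (pk : PubKey K.N) (words : List ℕ) (reg : ℕ → ℕ)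
    (cts : List (Ct K.N)) (hreg : ∀ i, 2 * K.N + 2 ≤ i → reg i = 0) :
    exec K (setRegs 0 (K.viewRegs words cts.length)) (K.memOf pk reg cts) =
      PMF.pure (View.load ⟨pk, cts, words⟩) := by
  rw [exec_setRegs]
  congr 1
  have : View.load ⟨pk, cts, words⟩ = Mem.mk (View.load ⟨pk, cts, words⟩).reg
    (fun i => cts.getD i default) pk := rfl
  rw [this]
  simp only [memOf, Mem.mk.injEq, and_true]
  funext i
  rw [← viewRegs_getD, Nat.sub_zero]
  split_ifs with h
  · rfl
  · have hl : (K.viewRegs words cts.length).length ≤ i := by omega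
    rw [List.getD_eq_default _ _ hl, hreg i]
    simp [viewRegs] at hl
    omega

/-- The number registers then contain the message `m` and the zero message one after the other, and
the ciphertext at address `0` has a copy at the address where the challenge belongs. -/
lemma exec_prepare_challenge (pk : PubKey K.N) (cts : List (Ct K.N)) (m : RingElt K.N)
    (reg : ℕ → ℕ) (hreg : ∀ i, 2 * K.N + 2 ≤ i → reg i = 0) :
    ∃ reg' : ℕ → ℕ, (∀ i, 2 * K.N + 2 ≤ i → reg' i = 0) ∧
      (∀ t : Fin K.N, reg' (0 + t) = (K.residues m).getD t 0) ∧
      (∀ t : Fin K.N, reg' (K.N + t) = (K.residues 0).getD t 0) ∧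
      exec K (setRegs 0 [0, cts.length] ++ ([.move 1 0] ++ setRegs 0 (K.residues m ++ K.residues 0)))
        (K.memOf pk reg cts) = PMF.pure ⟨reg', Function.update (fun i => cts.getD i default)
          cts.length (cts.getD 0 default), pk⟩ := by
  have hN := K.two_le_N
  refine ⟨fun i => if i < 2 * K.N then (K.residues m ++ K.residues 0).getD i 0 else
    if i < 2 then [0, cts.length].getD i 0 else reg i, ?_, ?_, ?_, ?_⟩
  · intro i hi
    simp only
    rw [if_neg (by omega), if_neg (by omega), hreg i hi]
  · intro t
    have := t.2
    beta_reduce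
    rw [if_pos (by omega), zero_add, List.getD_append _ _ _ _ (by simp [length_residues])]
  · intro t
    have := t.2
    beta_reduce
    rw [if_pos (by omega), List.getD_append_right _ _ _ _ (by simp [length_residues])]
    simp [length_residues]
  · simp only [exec_append, exec_setRegs, PMF.pure_bind, exec, step, memOf, Mem.setCt,
      List.length_append, length_residues, zero_le, true_and, zero_add, Nat.sub_zero, two_mul]
    simp

lemma exec_guessProg (pk : PubKey K.N) (τ : Transcript K.N) (words : List ℕ) (D : Prog)
    (cts : List (Ct K.N)) (c : Ct K.N) (reg : ℕ → ℕ) (hreg : ∀ i, 2 * K.N + 2 ≤ i → reg i = 0) :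
    exec K (K.guessProg cts.length τ (K.viewRegs words (cts.length + 1 + τ.weight)) D)
      ⟨reg, Function.update (Function.update (fun i => cts.getD i default) cts.length
          (cts.getD 0 default)) 0 c, pk⟩ =
      (K.replay pk τ (cts ++ [c])).bind fun d => exec K D (View.load ⟨pk, d, words⟩) := by
  have hN := K.two_le_N
  obtain ⟨reg', h', e⟩ := K.exec_replayProg pk τ (cts.length + 1)
    (fun i => if i < 4 then [0, cts.length, cts.length + 1, cts.length + 2].getD i 0 else reg i)
    (2 * K.N + 2) (by omega) (by
      intro i hi
      rw [if_neg (by omega), hreg i hi])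
  rw [guessProg, exec_append, exec_setRegs, PMF.pure_bind, exec_append]
  have := K.swap_challenge pk cts c reg
  simp only [zero_le, true_and, zero_add, List.length_cons, List.length_nil, Nat.sub_zero,
    Nat.reduceAdd] at this ⊢
  rw [this, PMF.pure_bind, exec_append, e _ (by simp), PMF.bind_map]
  refine bind_congr_of_support _ fun d hd => ?_
  have hlen : d.length = cts.length + 1 + τ.weight := by
    simpa using K.length_of_mem_support_replay pk τ _ d hd
  rw [← hlen, Function.comp_apply, exec_append, exec_setRegs_viewRegs _ _ _ _ _ h', PMF.pure_bind]

/-- The game in which one of the two messages is encrypted between the two halves of a transcript: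
with either bit the adversary faces the replay of a complete transcript. -/
lemma cpaGame_eq_acceptance (D : Prog) (pub : List Event → List ℕ) (σ τ : Transcript K.N)
    (m : RingElt K.N) (bit : Bool) :
    cpaGame K (K.challengeProg σ m)
        (K.guessProg σ.weight τ (K.viewRegs (pub (σ.map Prod.fst ++ Event.fresh :: τ.map Prod.fst))
          (σ.weight + 1 + τ.weight)) D) bit =
      (K.acceptance D pub (σ ++ (Event.fresh, if bit then 0 else m) :: τ) true).toReal := by
  have hN := K.two_le_N
  unfold cpaGame accepts acceptance
  congr 2
  rw [PMF.map_bind]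
  congr 1
  funext k
  obtain ⟨reg₁, h₁, e₁⟩ := K.exec_replayProg k.1 σ 0 (fun _ => 0) (2 * K.N + 2) (by omega)
    (fun _ _ => rfl)
  have e₁' := e₁ [] rfl
  have e0 : K.memOf k.1 (fun _ => 0) [] = ⟨fun _ => 0, fun _ => default, k.1⟩ := by
    simp [memOf]
  rw [e0] at e₁'
  rw [challengeProg, exec_append, e₁', CKKS.replay_append, PMF.bind_map, PMF.bind_bind,
    PMF.map_bind, PMF.bind_bind]
  refine bind_congr_of_support _ fun c hc => ?_
  have hlen : c.length = σ.weight := by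
    simpa using K.length_of_mem_support_replay k.1 σ [] c hc
  rw [← hlen]
  obtain ⟨reg₂, h₂, hm, h0, e₂⟩ := K.exec_prepare_challenge k.1 c m reg₁ h₁
  rw [Function.comp_apply, e₂, PMF.pure_bind]
  simp only [CKKS.replay, CKKS.advance]
  rw [K.enc_message k.1 (if bit then 0 else m)]
  swap
  · cases bit
    · exact hm
    · exact h0
  rw [PMF.bind_bind, PMF.bind_map, PMF.map_bind]
  congr 1
  funext d
  simp only [Mem.setCt, exec_guessProg _ _ _ _ _ _ _ _ h₂, PMF.map_bind, Function.comp_apply,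
    List.map_append, List.map_cons]

/-! ### The hybrid argument -/

/-- If no pair of programs of bounded size wins the game with advantage above `ε`, the plaintexts of
a transcript can be blanked one after the other, each time with a loss of at most `ε`. In the
statement the part `σ` of the transcript has been dealt with already. -/
lemma acceptance_sub_blank_le (D : Prog) (pub : List Event → List ℕ) {ε : ℝ} (hε : 0 ≤ ε)
    {b : ℕ} (hsec : ∀ A B : Prog, cost A ≤ b → cost B ≤ b →
      |cpaGame K A B false - cpaGame K A B true| ≤ ε)
    (σ τ : Transcript K.N)
    (hb : ∀ (σ' τ' : Transcript K.N) (m : RingElt K.N),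
      (σ' ++ (Event.fresh, m) :: τ').map Prod.fst = (σ ++ τ).map Prod.fst →
        cost (K.challengeProg σ' m) ≤ b ∧
        cost (K.guessProg σ'.weight τ' (K.viewRegs (pub ((σ ++ τ).map Prod.fst))
          (σ'.weight + 1 + τ'.weight)) D) ≤ b) :
    |(K.acceptance D pub (σ ++ τ) true).toReal -
      (K.acceptance D pub (σ ++ Transcript.blank τ) true).toReal| ≤ τ.length * ε := by
  induction τ generalizing σ with
  | nil => simp [Transcript.blank]
  | cons e τ ih =>
    have key : |(K.acceptance D pub (σ ++ e :: τ) true).toReal -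
        (K.acceptance D pub ((σ ++ [(e.1, 0)]) ++ τ) true).toReal| ≤ ε := by
      obtain ⟨e, m⟩ := e
      by_cases he : e = Event.fresh
      · subst he
        have hb' := hb σ τ m rfl
        have := hsec _ _ hb'.1 hb'.2
        rw [List.map_append, List.map_cons] at this
        rw [cpaGame_eq_acceptance, cpaGame_eq_acceptance] at this
        simpa using this
      · -- The entry of an event that is not an upload has no effect.
        have : K.acceptance D pub (σ ++ (e, m) :: τ) =
            K.acceptance D pub ((σ ++ [(e, 0)]) ++ τ) := by
          unfold acceptance
          have ha : ∀ pk cts, K.advance pk (e, m) cts = K.advance pk (e, 0) cts := by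
            intro pk cts
            cases e <;> first | rfl | exact absurd rfl he
          simp [replay_append, replay, ha]
        rw [this, sub_self, abs_zero]
        exact hε
    have := ih (σ ++ [(e.1, 0)]) (by
      intro σ' τ' m h
      have h' : ((σ ++ [(e.1, 0)]) ++ τ).map Prod.fst = (σ ++ e :: τ).map Prod.fst := by simp
      rw [h'] at h ⊢
      exact hb σ' τ' m h)
    have e2 : σ ++ Transcript.blank (e :: τ) = (σ ++ [(e.1, 0)]) ++ Transcript.blank τ := by
      simp [Transcript.blank]
    rw [e2]
    have tri := abs_sub_le (K.acceptance D pub (σ ++ e :: τ) true).toReal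
      (K.acceptance D pub ((σ ++ [(e.1, 0)]) ++ τ) true).toReal
      (K.acceptance D pub ((σ ++ [(e.1, 0)]) ++ Transcript.blank τ) true).toReal
    push_cast [List.length_cons]
    linarith

end CKKS

/-! ### Size of the adversary -/

namespace CKKS

variable (K : CKKS)

lemma cost_eventProg_le (e : Event × RingElt K.N) (t : ℕ) {w : ℕ}
    (hq : Nat.size (K.modulus K.depth) ≤ w) (ht : t ≤ w)
    (he : ∀ v ∈ e.1.words, Nat.size v ≤ w) : cost (K.eventProg e t) ≤ (K.N + 5) * (1 + w) := by
  obtain ⟨e, m⟩ := e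
  have ht' : Nat.size t ≤ w := (size_le_self t).trans ht
  cases e with
  | fresh =>
    have h1 := cost_setRegs_le 0 (K.residues m) w fun v hv =>
      (K.size_le_of_mem_residues m hv).trans hq
    have h2 := cost_setRegs_le K.N [t, 0] w (by simp [ht'])
    simp only [eventProg, cost_append, cost_cons, cost_nil, Instr.cost, length_residues,
      List.length_cons, List.length_nil] at *
    nlinarith
  | op o a b =>
    have hab : Nat.size a ≤ w ∧ Nat.size b ≤ w := by
      cases o <;> simp_all [Event.words]
    have h2 := cost_setRegs_le 0 [a, b, t] w (by simp [ht', hab])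
    simp only [eventProg, cost_append, cost_cons, cost_nil, Instr.cost,
      List.length_cons, List.length_nil] at *
    nlinarith [Nat.zero_le (K.N * (1 + w))]
  | draw r => simp [eventProg]
  | answer hs r => simp [eventProg]

lemma weight_le_one (e : Event) : e.weight ≤ 1 := by cases e <;> simp [Event.weight]

lemma weight_le_length {N : ℕ} (τ : Transcript N) : τ.weight ≤ τ.length := by
  induction τ with
  | nil => simp [Transcript.weight]
  | cons e τ ih =>
    have := weight_le_one e.1
    simp only [Transcript.weight, List.map_cons, List.sum_cons, List.length_cons] at *
    omega

lemma cost_replayProg_le (τ : Transcript K.N) (t : ℕ) {w : ℕ}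
    (hq : Nat.size (K.modulus K.depth) ≤ w) (ht : t + τ.length ≤ w)
    (he : ∀ e ∈ τ, ∀ v ∈ e.1.words, Nat.size v ≤ w) :
    cost (K.replayProg τ t) ≤ τ.length * ((K.N + 5) * (1 + w)) := by
  induction τ generalizing t with
  | nil => simp [replayProg]
  | cons e τ ih =>
    rw [List.length_cons] at ht
    have h1 := K.cost_eventProg_le e t hq (by omega) (he e (by simp))
    have hw := weight_le_one e.1
    have h2 := ih (t + e.1.weight) (by omega) fun e' h' => he e' (List.mem_cons_of_mem _ h')
    simp only [replayProg, cost_append, List.length_cons, add_mul, one_mul] at *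
    omega

/-- A bound for the size of both parts of the adversary, in terms of the ring degree `N`, the number
of events, the number and the bit length of public words, and the size of the distinguisher. -/
def adversaryBound (N n L w d : ℕ) : ℕ := n * ((N + 5) * (1 + w)) + (L + 4 * N + 20) * (1 + w) + d

lemma cost_challengeProg_le (σ τ : Transcript K.N) (m : RingElt K.N) {n L w d : ℕ}
    (hq : Nat.size (K.modulus K.depth) ≤ w) (hn : σ.length + 1 + τ.length ≤ n) (hw : n + 3 ≤ w)
    (he : ∀ e ∈ σ, ∀ v ∈ e.1.words, Nat.size v ≤ w) :
    cost (K.challengeProg σ m) ≤ adversaryBound K.N n L w d := by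
  have hσ := weight_le_length σ
  have h1 := K.cost_replayProg_le σ 0 hq (by omega) he
  have h2 := cost_setRegs_le 0 [0, σ.weight] w
    (by simp; exact (size_le_self _).trans (by omega))
  have h3 := cost_setRegs_le 0 (K.residues m ++ K.residues 0) w (by
    intro v hv
    rw [List.mem_append] at hv
    rcases hv with hv | hv <;> exact (K.size_le_of_mem_residues _ hv).trans hq)
  have h4 : σ.length * ((K.N + 5) * (1 + w)) ≤ n * ((K.N + 5) * (1 + w)) :=
    Nat.mul_le_mul_right _ (by omega)
  simp only [List.length_append, length_residues, List.length_cons, List.length_nil] at h2 h3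
  simp only [challengeProg, cost_append, cost_cons, cost_nil, Instr.cost, adversaryBound]
  nlinarith

lemma cost_guessProg_le (σ τ : Transcript K.N) (words : List ℕ) (D : Prog) {n L w : ℕ}
    (hq : Nat.size (K.modulus K.depth) ≤ w) (hn : σ.length + 1 + τ.length ≤ n) (hw : n + 3 ≤ w)
    (he : ∀ e ∈ τ, ∀ v ∈ e.1.words, Nat.size v ≤ w) (hL : words.length ≤ L) (hLw : L ≤ w)
    (hwords : ∀ v ∈ words, Nat.size v ≤ w) :
    cost (K.guessProg σ.weight τ (K.viewRegs words (σ.weight + 1 + τ.weight)) D) ≤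
      adversaryBound K.N n L w (cost D) := by
  have hσ := weight_le_length σ
  have hτ := weight_le_length τ
  have hs : ∀ k, k ≤ w → Nat.size k ≤ w := fun k hk => (size_le_self k).trans hk
  have h1 := K.cost_replayProg_le τ (σ.weight + 1) hq (by omega) he
  have h2 := cost_setRegs_le 0 [0, σ.weight, σ.weight + 1, σ.weight + 2] w (by
    intro v hv
    simp only [List.mem_cons, List.not_mem_nil, or_false] at hv
    exact hs v (by omega))
  have h3 := cost_setRegs_le 0 (K.viewRegs words (σ.weight + 1 + τ.weight)) w (by
    intro v hv
    simp only [viewRegs, List.mem_cons, List.mem_append, List.mem_replicate] at hv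
    rcases hv with rfl | rfl | hv | ⟨-, rfl⟩
    · exact hs _ (by omega)
    · exact hs _ (by omega)
    · exact hwords v hv
    · simp)
  have h4 : τ.length * ((K.N + 5) * (1 + w)) ≤ n * ((K.N + 5) * (1 + w)) :=
    Nat.mul_le_mul_right _ (by omega)
  have h5 : (words.length + 2 * K.N + 4) * (1 + w) ≤ (L + 2 * K.N + 4) * (1 + w) :=
    Nat.mul_le_mul_right _ (by omega)
  have h6 : (K.viewRegs words (σ.weight + 1 + τ.weight)).length = words.length + 2 * K.N + 4 := by
    simp [viewRegs]
    omega
  simp only [h6, List.length_cons, List.length_nil] at h2 h3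
  simp only [guessProg, cost_append, cost_cons, cost_nil, Instr.cost, adversaryBound]
  nlinarith [Nat.zero_le (K.N * (1 + w))]

end CKKS

/-! ### The leakage as a list of instructions -/

/-- An event as a list of triples of numbers, as in `Event.words`. The first entry is a tag; triples
with tags `1, …, 6` stand for events that produce a ciphertext. -/
def Event.triples : Event → List (ℕ × ℕ × ℕ)
  | .fresh => [(1, 0, 0)]
  | .op .add a b => [(2, a, b)]
  | .op .sub a b => [(3, a, b)]
  | .op .mul a b => [(4, a, b)]
  | .op .rot a b => [(5, a, b)]
  | .op .const a b => [(6, a, b)]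
  | .draw r => [(7, r, 0)]
  | .answer hs r => (8, hs.length, r.length) :: (hs.map fun h => (9, h, 0)) ++
      r.map fun i => (10, i, 0)

lemma Event.words_eq (e : Event) : e.words = e.triples.flatMap fun t => [t.1, t.2.1, t.2.2] := by
  match e with
  | .fresh => rfl
  | .op .add a b => rfl
  | .op .sub a b => rfl
  | .op .mul a b => rfl
  | .op .rot a b => rfl
  | .op .const a b => rfl
  | .draw r => rfl
  | .answer hs r => simp [Event.words, Event.triples, List.flatMap_map]

lemma length_words (ts : List (ℕ × ℕ × ℕ)) :
    (ts.flatMap fun t => [t.1, t.2.1, t.2.2]).length = 3 * ts.length := by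
  induction ts with
  | nil => rfl
  | cons t ts ih => simp [ih, mul_add]

/-- The entries of an encoded list of triples; beyond the end of the list they are zero. -/
lemma getD_words (ts : List (ℕ × ℕ × ℕ)) (i : ℕ) :
    let l := ts.flatMap fun t => [t.1, t.2.1, t.2.2]
    (l.getD (3 * i) 0, l.getD (3 * i + 1) 0, l.getD (3 * i + 2) 0) = ts.getD i (0, 0, 0) := by
  induction ts generalizing i with
  | nil => simp
  | cons t ts ih =>
    cases i with
    | zero => simp
    | succ i =>
      have := ih i
      simpa [mul_add] using this

namespace CKKS

variable (K : CKKS)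

/-- The ciphertexts that the simulator holds after one more triple of the leakage: it encrypts zero
in place of every uploaded plaintext. -/
def simulate (pk : PubKey K.N) (t : ℕ × ℕ × ℕ) (cts : List (Ct K.N)) : PMF (List (Ct K.N)) :=
  match t with
  | (1, _, _) => (K.enc pk 0).map fun c => cts ++ [c]
  | (2, a, b) => PMF.pure (cts ++ [K.evalOp pk .add a b fun h => cts.getD h default])
  | (3, a, b) => PMF.pure (cts ++ [K.evalOp pk .sub a b fun h => cts.getD h default])
  | (4, a, b) => PMF.pure (cts ++ [K.evalOp pk .mul a b fun h => cts.getD h default])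
  | (5, a, b) => PMF.pure (cts ++ [K.evalOp pk .rot a b fun h => cts.getD h default])
  | (6, a, b) => PMF.pure (cts ++ [K.evalOp pk .const a b fun h => cts.getD h default])
  | _ => PMF.pure cts

/-- The ciphertexts that the simulator holds after several triples. -/
def simulateAll (pk : PubKey K.N) : List (ℕ × ℕ × ℕ) → List (Ct K.N) → PMF (List (Ct K.N))
  | [], cts => PMF.pure cts
  | t :: ts, cts => (K.simulate pk t cts).bind (simulateAll pk ts)

lemma simulateAll_append (pk : PubKey K.N) (ts us : List (ℕ × ℕ × ℕ)) (cts : List (Ct K.N)) :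
    K.simulateAll pk (ts ++ us) cts = (K.simulateAll pk ts cts).bind (K.simulateAll pk us) := by
  induction ts generalizing cts with
  | nil => simp [simulateAll]
  | cons t ts ih => simp only [List.cons_append, simulateAll, PMF.bind_bind, funext ih]

/-- Triples that do not produce a ciphertext are ignored. -/
lemma simulateAll_of_idle (pk : PubKey K.N) (ts : List (ℕ × ℕ × ℕ)) (cts : List (Ct K.N))
    (h : ∀ t ∈ ts, ∀ c, K.simulate pk t c = PMF.pure c) :
    K.simulateAll pk ts cts = PMF.pure cts := by
  induction ts with
  | nil => rfl
  | cons t ts ih =>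
    rw [simulateAll, h t (by simp), PMF.pure_bind, ih fun u hu => h u (List.mem_cons_of_mem _ hu)]

lemma simulateAll_triples (pk : PubKey K.N) (e : Event) (cts : List (Ct K.N)) :
    K.simulateAll pk e.triples cts = K.advance pk (e, 0) cts := by
  match e with
  | .fresh => simp [Event.triples, simulateAll, simulate, advance]
  | .op .add a b => simp [Event.triples, simulateAll, simulate, advance]
  | .op .sub a b => simp [Event.triples, simulateAll, simulate, advance]
  | .op .mul a b => simp [Event.triples, simulateAll, simulate, advance]
  | .op .rot a b => simp [Event.triples, simulateAll, simulate, advance]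
  | .op .const a b => simp [Event.triples, simulateAll, simulate, advance]
  | .draw r => simp [Event.triples, simulateAll, simulate, advance]
  | .answer hs r =>
    refine K.simulateAll_of_idle pk _ _ fun t ht c => ?_
    simp only [Event.triples, List.cons_append, List.mem_cons, List.mem_append, List.mem_map] at ht
    rcases ht with rfl | ⟨h, -, rfl⟩ | ⟨h, -, rfl⟩ <;> rfl

/-- Simulation of the whole leakage is the replay of the blanked transcript. -/
lemma simulateAll_flatMap (pk : PubKey K.N) (es : List Event) (cts : List (Ct K.N)) :
    K.simulateAll pk (es.flatMap Event.triples) cts =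
      K.replay pk (es.map fun e => (e, 0)) cts := by
  induction es generalizing cts with
  | nil => rfl
  | cons e es ih =>
    simp only [List.flatMap_cons, simulateAll_append, simulateAll_triples, List.map_cons, replay,
      funext ih]

end CKKS

/-! ### The simulator -/

/-- Simulation of one triple, which stands in the registers `p`, `p + 1`, `p + 2`. Registers from `Z`
on and ciphertext registers from `X` on are free. Since programs have no branches, all alternatives
are computed: for every tag `k` that produces a ciphertext the candidate goes to ciphertext register
`X + k`. Addresses are cut off at the number of ciphertexts, where the default ciphertext is stored.
The candidate with the right tag is copied, and the number of ciphertexts, which is in register `1`,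
grows if the tag is one of `1, …, 6`. -/
def simBody (p Z X : ℕ) : Prog :=
  [.sub Z (p + 1) 1, .sub Z (p + 1) Z, .sub (Z + 1) (p + 2) 1, .sub (Z + 1) (p + 2) (Z + 1),
    .const (Z + 3) (Z + 8), .const (Z + 2) (X + 1), .enc (Z + 2) (Z + 3),
    .const (Z + 2) (X + 2), .eval .add (Z + 2) Z (Z + 1),
    .const (Z + 2) (X + 3), .eval .sub (Z + 2) Z (Z + 1),
    .const (Z + 2) (X + 4), .eval .mul (Z + 2) Z (Z + 1),
    .const (Z + 2) (X + 5), .eval .rot (Z + 2) Z (p + 2),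
    .const (Z + 2) (X + 6), .eval .const (Z + 2) (p + 1) (p + 2),
    .const (Z + 2) X, .add (Z + 2) (Z + 2) p, .move 1 (Z + 2),
    .const (Z + 4) 1, .const (Z + 5) 6, .sub (Z + 5) p (Z + 5), .sub (Z + 6) (Z + 4) p,
    .sub (Z + 4) (Z + 4) (Z + 6), .sub (Z + 4) (Z + 4) (Z + 5), .add 1 1 (Z + 4)]

namespace CKKS

variable (K : CKKS)

/-- What the simulator has in its memory when it holds the ciphertexts `cts`, at most `T` in number. -/
structure SimState (T : ℕ) (pk : PubKey K.N) (words : List ℕ) (cts : List (Ct K.N))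
    (m : Mem K.N) : Prop where
  key : m.key = pk
  zero : m.reg 0 = words.length
  one : m.reg 1 = cts.length
  input : ∀ j, j < 4 + 3 * T → m.reg (j + 2) = words.getD j 0
  free : ∀ j, 6 + 3 * T + 8 ≤ j → m.reg j = 0
  ct : ∀ j, j ≤ T → m.ct j = cts.getD j default
  idle : m.ct (T + 1) = default
  high : ∀ j, T + 1 + 7 ≤ j → m.ct j = default

/-- The candidate ciphertexts computed by the simulator, by their tags; `c` is the encryption of
zero. -/
def candidate (pk : PubKey K.N) (a b : ℕ) (c : Ct K.N) (cts : List (Ct K.N)) : ℕ → Ct K.N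
  | 1 => c
  | 2 => K.evalOp pk .add a b fun h => cts.getD h default
  | 3 => K.evalOp pk .sub a b fun h => cts.getD h default
  | 4 => K.evalOp pk .mul a b fun h => cts.getD h default
  | 5 => K.evalOp pk .rot a b fun h => cts.getD h default
  | 6 => K.evalOp pk .const a b fun h => cts.getD h default
  | _ => default

/-- The simulator encrypts zero for every triple; the result is discarded unless the tag is `1`. -/
lemma simulate_eq (pk : PubKey K.N) (t a b : ℕ) (cts : List (Ct K.N)) :
    K.simulate pk (t, a, b) cts = (K.enc pk 0).map fun c =>
      if 1 ≤ t ∧ t ≤ 6 then cts ++ [K.candidate pk a b c cts t] else cts := by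
  have hc : ∀ l : List (Ct K.N), PMF.map (fun _ => l) (K.enc pk 0) = PMF.pure l := by
    intro l
    rw [← PMF.bind_pure_comp]
    exact PMF.bind_const _ _
  match t with
  | 0 => simp [simulate, hc]
  | 1 => simp [simulate, candidate]
  | 2 => simp [simulate, candidate, hc]
  | 3 => simp [simulate, candidate, hc]
  | 4 => simp [simulate, candidate, hc]
  | 5 => simp [simulate, candidate, hc]
  | 6 => simp [simulate, candidate, hc]
  | t + 7 =>
    have : ¬ (t + 7 ≤ 6) := by omega
    simp [simulate, hc, this]

/-- Cutting off an address, here by truncated subtraction, does not change the content that is found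
there. -/
lemma getD_min_length (cts : List (Ct K.N)) (a : ℕ) :
    cts.getD (a - (a - cts.length)) default = cts.getD a default := by
  rcases le_or_gt a cts.length with h | h
  · rw [Nat.sub_eq_zero_of_le h, Nat.sub_zero]
  · rw [List.getD_eq_default _ _ (by omega), List.getD_eq_default _ _ h.le]

lemma exec_const_eval (d k u v : ℕ) (o : Op) (A : Prog) (reg : ℕ → ℕ) (ct : ℕ → Ct K.N)
    (pk : PubKey K.N) (hu : u ≠ d) (hv : v ≠ d) :
    exec K (.const d k :: .eval o d u v :: A) ⟨reg, ct, pk⟩ =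
      exec K A ⟨Function.update reg d k,
        Function.update ct k (K.evalOp pk o (reg u) (reg v) ct), pk⟩ := by
  simp only [exec, step, PMF.pure_bind, Mem.setReg, Mem.setCt, Function.update_self,
    Function.update_of_ne hu, Function.update_of_ne hv]

/-- Cut off the two addresses. -/
lemma exec_clip (p Z : ℕ) (hp : 2 ≤ p) (hZ : p + 2 < Z) (reg : ℕ → ℕ) (ct : ℕ → Ct K.N)
    (pk : PubKey K.N) :
    ∃ reg' : ℕ → ℕ, reg' Z = reg (p + 1) - (reg (p + 1) - reg 1) ∧
      reg' (Z + 1) = reg (p + 2) - (reg (p + 2) - reg 1) ∧ reg' (Z + 3) = Z + 8 ∧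
      (∀ j, j < Z ∨ Z + 8 ≤ j → reg' j = reg j) ∧
      ∀ A : Prog, exec K (.sub Z (p + 1) 1 :: .sub Z (p + 1) Z :: .sub (Z + 1) (p + 2) 1 ::
        .sub (Z + 1) (p + 2) (Z + 1) :: .const (Z + 3) (Z + 8) :: A) ⟨reg, ct, pk⟩ =
          exec K A ⟨reg', ct, pk⟩ := by
  refine ⟨_, ?_, ?_, ?_, ?_, fun A => by
    simp only [exec, step, PMF.pure_bind, Mem.setReg]; exact rfl⟩
  all_goals
    have e1 : p + 1 ≠ Z := by omega
    have e2 : p + 2 ≠ Z := by omega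
    have e3 : p + 2 ≠ Z + 1 := by omega
    have e4 : 1 ≠ Z := by omega
    have e5 : p + 1 ≠ Z + 1 := by omega
    have e6 : 1 ≠ Z + 1 := by omega
  · simp [e1]
  · simp [e2, e3, e4]
  · simp
  · intro j hj
    have f0 : j ≠ Z := by omega
    have f1 : j ≠ Z + 1 := by omega
    have f3 : j ≠ Z + 3 := by omega
    simp [f0, f1, f3]

/-- Compute the candidates for all tags. -/
lemma exec_candidates (Z X a b n : ℕ) (p : ℕ) (hp : p + 2 < Z) (reg : ℕ → ℕ) (ct : ℕ → Ct K.N)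
    (pk : PubKey K.N) (cts : List (Ct K.N)) (hn : cts.length = n) (hX : n < X)
    (hct : ∀ j, j < X → ct j = cts.getD j default) (ha : reg Z = a - (a - n))
    (hb : reg (Z + 1) = b - (b - n)) (hz : reg (Z + 3) = Z + 8)
    (hpa : reg (p + 1) = a) (hpb : reg (p + 2) = b) (hfree : ∀ j, Z + 8 ≤ j → reg j = 0) :
    ∃ (reg' : ℕ → ℕ) (F : Ct K.N → ℕ → Ct K.N), (∀ j, j ≠ Z + 2 → reg' j = reg j) ∧
      (∀ c t, 1 ≤ t → t ≤ 6 → F c (X + t) = K.candidate pk a b c cts t) ∧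
      (∀ c j, j ≤ X ∨ X + 7 ≤ j → F c j = ct j) ∧
      ∀ A : Prog, exec K (.const (Z + 2) (X + 1) :: .enc (Z + 2) (Z + 3) ::
        .const (Z + 2) (X + 2) :: .eval .add (Z + 2) Z (Z + 1) ::
        .const (Z + 2) (X + 3) :: .eval .sub (Z + 2) Z (Z + 1) ::
        .const (Z + 2) (X + 4) :: .eval .mul (Z + 2) Z (Z + 1) ::
        .const (Z + 2) (X + 5) :: .eval .rot (Z + 2) Z (p + 2) ::
        .const (Z + 2) (X + 6) :: .eval .const (Z + 2) (p + 1) (p + 2) :: A) ⟨reg, ct, pk⟩ =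
          (K.enc pk 0).bind fun c => exec K A ⟨reg', F c, pk⟩ := by
  have ha' : a - (a - n) < X := by omega
  have hb' : b - (b - n) < X := by omega
  have la : cts.getD (a - (a - n)) default = cts.getD a default := by
    rw [← hn]; exact K.getD_min_length cts a
  have lb : cts.getD (b - (b - n)) default = cts.getD b default := by
    rw [← hn]; exact K.getD_min_length cts b
  have hm : (Mem.mk (Function.update reg (Z + 2) (X + 1)) ct pk).message (Z + 8) =
      (0 : RingElt K.N) := by
    funext t
    have : Z + 8 + (t : ℕ) ≠ Z + 2 := by omega
    simp only [Mem.message, Function.update_of_ne this, hfree _ (Nat.le_add_right _ _)]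
    rfl
  have e1 : p + 1 ≠ Z + 2 := by omega
  have e2 : p + 2 ≠ Z + 2 := by omega
  have e3 : Z ≠ Z + 2 := by omega
  have e4 : Z + 1 ≠ Z + 2 := by omega
  have e5 : Z + 3 ≠ Z + 2 := by omega
  refine ⟨_, _, ?_, ?_, ?_, fun A => by
    rw [exec, step, PMF.pure_bind, exec, step]
    simp only [Mem.setReg, Function.update_of_ne e5, hz, hm, Function.update_self, PMF.bind_map,
      Mem.setCt, Function.comp_def]
    simp only [exec_const_eval K _ _ _ _ _ _ _ _ _ e3 e4, exec_const_eval K _ _ _ _ _ _ _ _ _ e3 e2,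
      exec_const_eval K _ _ _ _ _ _ _ _ _ e1 e2, Function.update_of_ne e1,
      Function.update_of_ne e2, Function.update_of_ne e3, Function.update_of_ne e4,
      Function.update_idem, ha, hb, hpa, hpb]
    exact rfl⟩
  · intro j hj
    simp [hj]
  · intro c t h1 h6
    have o1 : ∀ k, a - (a - n) ≠ X + k := by omega
    have o2 : ∀ k, b - (b - n) ≠ X + k := by omega
    interval_cases t
    · simp [candidate]
    · simp [candidate, evalOp, o1, o2, hct _ ha', hct _ hb', la, lb,
        -List.getD_eq_getElem?_getD]
    · simp [candidate, evalOp, o1, o2, hct _ ha', hct _ hb', la, lb,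
        -List.getD_eq_getElem?_getD]
    · simp [candidate, evalOp, o1, o2, hct _ ha', hct _ hb', la, lb,
        -List.getD_eq_getElem?_getD]
    · simp [candidate, evalOp, o1, o2, hct _ ha', hct _ hb', la, lb,
        -List.getD_eq_getElem?_getD]
    · simp [candidate, evalOp]
  · intro c j hj
    have o1 : j ≠ X + 1 := by omega
    have o2 : j ≠ X + 2 := by omega
    have o3 : j ≠ X + 3 := by omega
    have o4 : j ≠ X + 4 := by omega
    have o5 : j ≠ X + 5 := by omega
    have o6 : j ≠ X + 6 := by omega
    simp [o1, o2, o3, o4, o5, o6]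

/-- Copy the candidate with the right tag and adjust the number of ciphertexts. -/
lemma exec_select (p Z X : ℕ) (hZ : p < Z) (reg : ℕ → ℕ) (ct : ℕ → Ct K.N)
    (pk : PubKey K.N) :
    ∃ reg' : ℕ → ℕ, reg' 1 = reg 1 + (if 1 ≤ reg p ∧ reg p ≤ 6 then 1 else 0) ∧
      (∀ j, j ≠ 1 → j < Z ∨ Z + 8 ≤ j → reg' j = reg j) ∧
      exec K [.const (Z + 2) X, .add (Z + 2) (Z + 2) p, .move 1 (Z + 2),
        .const (Z + 4) 1, .const (Z + 5) 6, .sub (Z + 5) p (Z + 5), .sub (Z + 6) (Z + 4) p,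
        .sub (Z + 4) (Z + 4) (Z + 6), .sub (Z + 4) (Z + 4) (Z + 5), .add 1 1 (Z + 4)]
        ⟨reg, ct, pk⟩ =
          PMF.pure ⟨reg', Function.update ct (reg 1) (ct (X + reg p)), pk⟩ := by
  have e1 : 1 ≠ Z + 2 := by omega
  have e2 : p ≠ Z + 2 := by omega
  have e3 : 1 ≠ Z + 4 := by omega
  have e4 : p ≠ Z + 4 := by omega
  have e5 : 1 ≠ Z + 5 := by omega
  have e6 : p ≠ Z + 5 := by omega
  have e7 : 1 ≠ Z + 6 := by omega
  refine ⟨_, ?_, ?_, by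
    simp only [exec, step, PMF.pure_bind, Mem.setReg, Mem.setCt, Function.update_self,
      Function.update_of_ne e1, Function.update_of_ne e2]
    exact rfl⟩
  · simp [e2, e4, e6]
    split_ifs <;> omega
  · intro j h1 hj
    have f2 : j ≠ Z + 2 := by omega
    have f4 : j ≠ Z + 4 := by omega
    have f5 : j ≠ Z + 5 := by omega
    have f6 : j ≠ Z + 6 := by omega
    simp [h1, f2, f4, f5, f6]

/-- The program for one triple has the effect of `CKKS.simulate`, in the form of `simulate_eq`. -/
lemma exec_simBody {T : ℕ} {pk : PubKey K.N} {words : List ℕ} {cts : List (Ct K.N)} {m : Mem K.N}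
    (hm : K.SimState T pk words cts m) {i : ℕ} (hi : i < T)
    (hcts : cts.length ≤ i) :
    ∃ F : Ct K.N → Mem K.N,
      exec K (simBody (6 + 3 * i) (6 + 3 * T) (T + 1)) m = (K.enc pk 0).map F ∧
      ∀ c, K.SimState T pk words
        (if 1 ≤ words.getD (4 + 3 * i) 0 ∧ words.getD (4 + 3 * i) 0 ≤ 6 then
          cts ++ [K.candidate pk (words.getD (4 + 3 * i + 1) 0) (words.getD (4 + 3 * i + 2) 0) c cts
            (words.getD (4 + 3 * i) 0)] else cts) (F c) := by
  obtain ⟨reg, ct, key⟩ := m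
  obtain ⟨rfl, h0, h1, hin, hfree, hct, hidle, hhigh⟩ := hm
  simp only at h0 h1 hin hfree hct hidle hhigh
  have ep : reg (6 + 3 * i) = words.getD (4 + 3 * i) 0 := by
    rw [← hin _ (by omega)]; congr 1; omega
  have eq : reg (6 + 3 * i + 1) = words.getD (4 + 3 * i + 1) 0 := by
    rw [← hin _ (by omega)]; congr 1; omega
  have er : reg (6 + 3 * i + 2) = words.getD (4 + 3 * i + 2) 0 := by
    rw [← hin _ (by omega)]; congr 1; omega
  generalize words.getD (4 + 3 * i) 0 = t at *
  generalize words.getD (4 + 3 * i + 1) 0 = a at *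
  generalize words.getD (4 + 3 * i + 2) 0 = b at *
  obtain ⟨r₁, a₁, b₁, z₁, f₁, x₁⟩ := K.exec_clip (6 + 3 * i) (6 + 3 * T) (by omega) (by omega)
    reg ct key
  obtain ⟨r₂, F, f₂, g₂, k₂, x₂⟩ := K.exec_candidates (6 + 3 * T) (T + 1) a b cts.length (6 + 3 * i)
    (by omega) r₁ ct key cts rfl (by omega) (fun j hj => hct j (by omega))
    (by rw [a₁, eq, h1]) (by rw [b₁, er, h1]) z₁ (by rw [f₁ _ (by omega), eq])
    (by rw [f₁ _ (by omega), er]) (fun j hj => by rw [f₁ _ (by omega), hfree j hj])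
  have hr₂ : ∀ j, j < 6 + 3 * T ∨ 6 + 3 * T + 8 ≤ j → r₂ j = reg j := fun j hj => by
    rw [f₂ j (by omega), f₁ j hj]
  have e1 : r₂ 1 = cts.length := by rw [hr₂ 1 (by omega), h1]
  have et : r₂ (6 + 3 * i) = t := by rw [hr₂ _ (by omega), ep]
  -- For tags outside `1, …, 6` the default ciphertext is copied to a place where it already is.
  choose r₃ c₃ f₃ x₃ using fun c =>
    K.exec_select (6 + 3 * i) (6 + 3 * T) (T + 1) (by omega) r₂ (F c) key
  have hr₃ : ∀ c j, j ≠ 1 → j < 6 + 3 * T ∨ 6 + 3 * T + 8 ≤ j → r₃ c j = reg j := fun c j h1 hj => by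
    rw [f₃ c j h1 hj, hr₂ j hj]
  refine ⟨fun c => ⟨r₃ c, Function.update (F c) (r₂ 1) (F c (T + 1 + r₂ (6 + 3 * i))), key⟩, ?_, ?_⟩
  · simp only [simBody, x₁, x₂, x₃]
    exact PMF.bind_pure_comp _ _
  · intro c
    rw [e1, et]
    have hlen : cts.length ≠ T + 1 := by omega
    refine ⟨rfl, ?_, ?_, ?_, ?_, ?_, ?_, ?_⟩
    · exact (hr₃ c 0 (by omega) (by omega)).trans h0
    · simp only [c₃, e1, et]
      split_ifs <;> simp
    · intro j hj
      exact (hr₃ c _ (by omega) (by omega)).trans (hin j hj)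
    · intro j hj
      exact (hr₃ c _ (by omega) (by omega)).trans (hfree j hj)
    · intro j hj
      simp only
      by_cases hjl : j = cts.length
      · subst hjl
        rw [Function.update_self]
        split_ifs with h
        · rw [g₂ c t h.1 h.2]
          simp
        · rw [List.getD_eq_default _ _ le_rfl, k₂ c _ (by omega)]
          rcases Nat.eq_zero_or_pos t with rfl | h'
          · exact hidle
          · exact hhigh _ (by omega)
      · rw [Function.update_of_ne hjl, k₂ c _ (by omega), hct j hj]
        split_ifs with h
        · rcases lt_or_ge j cts.length with h' | h'
          · rw [List.getD_append _ _ _ _ h']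
          · rw [List.getD_eq_default _ _ h', List.getD_eq_default _ _ (by simp; omega)]
        · rfl
    · simp only
      rw [Function.update_of_ne hlen.symm, k₂ c _ (by omega), hidle]
    · intro j hj
      simp only
      rw [Function.update_of_ne (by omega), k₂ c _ (by omega), hhigh j hj]

/-- The simulation of `n` triples, beginning with triple number `i`. -/
def _root_.PRAG.simLoop (T : ℕ) : ℕ → ℕ → Prog
  | _, 0 => []
  | i, n + 1 => simBody (6 + 3 * i) (6 + 3 * T) (T + 1) ++ simLoop T (i + 1) n

/-- The simulator, for leakages of at most `T` triples. The words of the leakage stay where they are, as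
part of the output. -/
def _root_.PRAG.simulator (T : ℕ) : Prog := .keygen :: simLoop T 0 T

/-- Here `us` are the triples from number `i` on, which are read from the registers. -/
lemma exec_simLoop {T : ℕ} {pk : PubKey K.N} {words : List ℕ} (hw : words.length ≤ 4 + 3 * T)
    (us : List (ℕ × ℕ × ℕ)) (i : ℕ) (hi : i + us.length = T)
    (hus : ∀ j, j < us.length → us.getD j (0, 0, 0) = (words.getD (4 + 3 * (i + j)) 0,
      words.getD (4 + 3 * (i + j) + 1) 0, words.getD (4 + 3 * (i + j) + 2) 0))
    (cts : List (Ct K.N)) (hcts : cts.length ≤ i) (m : Mem K.N)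
    (hm : K.SimState T pk words cts m) :
    (exec K (simLoop T i us.length) m).map Mem.toView =
      (K.simulateAll pk us cts).map fun c => ⟨pk, c, words⟩ := by
  induction us generalizing i cts m with
  | nil =>
    simp only [List.length_nil, simLoop, exec, simulateAll, PMF.pure_map]
    congr 1
    simp only [Mem.toView, View.mk.injEq]
    simp only [List.length_nil, add_zero] at hi
    refine ⟨hm.key, ?_, ?_⟩
    · rw [hm.one]
      refine List.ext_getElem (by simp) fun j h1 h2 => ?_
      simp only [List.getElem_map, List.getElem_range]
      rw [hm.ct j (by omega)]
      exact List.getD_eq_getElem _ _ h2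
    · rw [hm.zero]
      refine List.ext_getElem (by simp) fun j h1 h2 => ?_
      simp only [List.getElem_map, List.getElem_range]
      rw [hm.input j (by omega)]
      exact List.getD_eq_getElem _ _ h2
  | cons u us ih =>
    obtain ⟨t, a, b⟩ := u
    rw [List.length_cons] at hi
    have hu := hus 0 (by simp)
    simp only [List.getD_cons_zero, add_zero, Prod.mk.injEq] at hu
    obtain ⟨F, hF, hF'⟩ := K.exec_simBody hm (i := i) (by omega) hcts
    rw [← hu.1, ← hu.2.1, ← hu.2.2] at hF'
    simp only [List.length_cons, simLoop, exec_append, hF, simulateAll, simulate_eq, PMF.bind_map,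
      PMF.map_bind]
    congr 1
    funext c
    refine ih (i + 1) (by omega) ?_ _ ?_ _ (hF' c)
    · intro j hj
      have := hus (j + 1) (by simpa using hj)
      rw [List.getD_cons_succ] at this
      rw [this]
      have e : i + (j + 1) = i + 1 + j := by omega
      rw [e]
    · split_ifs
      · simp; omega
      · exact hcts.trans (by omega)

lemma _root_.PRAG.Leakage.words_eq (L : Leakage) :
    L.words = [L.size, L.dim, L.clusters, L.topK] ++
      (L.events.flatMap Event.triples).flatMap fun t => [t.1, t.2.1, t.2.2] := by
  simp only [Leakage.words, List.flatMap_assoc, ← Event.words_eq]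

/-- From the leakage the simulator produces the replay of the blanked transcript with a fresh key. -/
lemma exec_simulator (L : Leakage) (T : ℕ) (hT : (L.events.flatMap Event.triples).length ≤ T) :
    (exec K (simulator T) (View.load ⟨default, [], L.words⟩)).map Mem.toView =
      K.keyGen.bind fun k => (K.replay k.1 (L.events.map fun e => (e, 0)) []).map fun c =>
        ⟨k.1, c, L.words⟩ := by
  set ts := L.events.flatMap Event.triples with hts
  have hw : L.words.length = 4 + 3 * ts.length := by
    rw [L.words_eq, List.length_append, length_words]
    rfl
  -- Beyond the end of the leakage the simulator reads zeros, which stand for idle triples.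
  set us := ts ++ List.replicate (T - ts.length) (0, 0, 0) with hus
  have hlen : us.length = T := by simp [hus]; omega
  have hwords : ∀ j, us.getD j (0, 0, 0) = (L.words.getD (4 + 3 * j) 0,
      L.words.getD (4 + 3 * j + 1) 0, L.words.getD (4 + 3 * j + 2) 0) := by
    intro j
    have h1 : us.getD j (0, 0, 0) = ts.getD j (0, 0, 0) := by
      rcases lt_or_ge j ts.length with h | h
      · rw [hus, List.getD_append _ _ _ _ h]
      · rw [hus, List.getD_append_right _ _ _ _ h, List.getD_eq_default _ _ h]
        simp [List.getD_eq_getElem?_getD, List.getElem?_replicate]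
        split_ifs <;> rfl
    rw [h1, ← getD_words, L.words_eq]
    have h4 : ∀ (l : List ℕ) n, ([L.size, L.dim, L.clusters, L.topK] ++ l).getD (4 + n) 0 =
        l.getD n 0 := by
      intro l n
      rw [List.getD_append_right _ _ _ _ (by simp)]
      simp
    simp only [add_assoc, h4]
    rfl
  simp only [simulator, exec, step, PMF.bind_map, PMF.map_bind]
  congr 1
  funext k
  have := K.exec_simLoop (T := T) (pk := k.1) (words := L.words) (by omega) us 0 (by omega)
    (fun j _ => by rw [zero_add]; exact hwords j) [] (by simp)
    { View.load ⟨default, [], L.words⟩ with key := k.1 } (by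
      refine ⟨rfl, rfl, rfl, fun j _ => rfl, ?_, ?_, ?_, ?_⟩
      · intro j hj
        obtain ⟨j, rfl⟩ : ∃ i, j = i + 2 := ⟨j - 2, by omega⟩
        exact List.getD_eq_default _ _ (by simp only; omega)
      all_goals simp [View.load])
  rw [hlen] at this
  rw [Function.comp_apply, this, hus, simulateAll_append, ← simulateAll_flatMap]
  have hidle : K.simulateAll k.1 (List.replicate (T - ts.length) (0, 0, 0)) = PMF.pure := by
    funext c
    refine K.simulateAll_of_idle k.1 _ c fun u hu c => ?_
    rw [List.eq_of_mem_replicate hu]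
    rfl
  rw [hidle, PMF.bind_pure]

end CKKS

lemma cost_le_length_mul (A : Prog) (w : ℕ) (h : ∀ I ∈ A, I.cost ≤ w) :
    cost A ≤ A.length * w := by
  simpa [cost] using List.sum_le_card_nsmul (A.map Instr.cost) w (by simpa using h)

lemma cost_simulator_le (T : ℕ) : cost (simulator T) ≤ 1 + T * (27 * (1 + (3 * T + 14))) := by
  have hs : ∀ k, k ≤ 3 * T + 14 → Nat.size k ≤ 3 * T + 14 := fun k hk => (size_le_self k).trans hk
  have hb : ∀ p, cost (simBody p (6 + 3 * T) (T + 1)) ≤ 27 * (1 + (3 * T + 14)) := by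
    intro p
    refine cost_le_length_mul _ _ fun I hI => ?_
    simp only [simBody, List.mem_cons, List.not_mem_nil, or_false] at hI
    rcases hI with rfl | rfl | rfl | rfl | rfl | rfl | rfl | rfl | rfl | rfl | rfl | rfl | rfl | rfl |
      rfl | rfl | rfl | rfl | rfl | rfl | rfl | rfl | rfl | rfl | rfl | rfl | rfl <;>
    first
    | exact Nat.add_le_add_left (hs _ (by omega)) 1
    | exact Nat.le_add_right 1 _
  have hl : ∀ n i, cost (simLoop T i n) ≤ n * (27 * (1 + (3 * T + 14))) := by
    intro n
    induction n with
    | zero => simp [simLoop]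
    | succ n ih =>
      intro i
      have := ih (i + 1)
      have := hb (6 + 3 * i)
      simp only [simLoop, cost_append, add_mul, one_mul] at *
      omega
  simp only [simulator, cost_cons, Instr.cost]
  have := hl T 0
  omega

/-! ### The length of the protocol -/

/-- `Bounded B Q p c`: whatever the random choices, the addresses of new ciphertexts (as long as they
have at most `B` bits), and the positions found by the client are, the protocol `p` produces at most
`c` triples of public numbers, of bounded length, and its result satisfies `Q`. The number `B` is a
parameter, so that it can be chosen after `c`: the addresses are at most the number of ciphertexts,
which is at most `c`. Random choices that the server does not see are counted too. -/
inductive Bounded (B : ℕ) {α : Type} (Q : α → Prop) : Proto α → ℕ → Prop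
  | done {a : α} {c : ℕ} : Q a → Bounded B Q (.done a) c
  | draw {v : Bool} {n : ℕ} {k : Fin (n + 1) → Proto α} {c c' : ℕ} : (v = true → n ≤ B) →
      (∀ r, Bounded B Q (k r) c) → c + 1 ≤ c' → Bounded B Q (.draw v n k) c'
  | fresh {src : Source} {k : ℕ → Proto α} {c c' : ℕ} :
      (∀ h, Nat.size h ≤ B → Bounded B Q (k h) c) → c + 1 ≤ c' → Bounded B Q (.fresh src k) c'
  | op {o : Op} {a b : ℕ} {k : ℕ → Proto α} {c c' : ℕ} : Nat.size a ≤ B → Nat.size b ≤ B →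
      (∀ h, Nat.size h ≤ B → Bounded B Q (k h) c) → c + 1 ≤ c' → Bounded B Q (.op o a b k) c'
  | peek {hs : List ℕ} {m : ℕ} {k : List ℕ → Proto α} {c : ℕ} :
      (∀ r, r.length ≤ m → (∀ i ∈ r, i < hs.length) → Bounded B Q (k r) c) →
        Bounded B Q (.peek hs m k) c
  | tell {hs r : List ℕ} {k : Proto α} {c c' : ℕ} : (∀ h ∈ hs, Nat.size h ≤ B) →
      (∀ i ∈ r, Nat.size i ≤ B + hs.length) → Bounded B Q k c →
        c + (1 + hs.length + r.length) ≤ c' → Bounded B Q (.tell hs r k) c'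

lemma smallest_spec (vals : List ℝ) (m : ℕ) :
    (smallest vals m).length ≤ m ∧ ∀ i ∈ smallest vals m, i < vals.length := by
  classical
  constructor
  · simp [smallest]
  · intro i hi
    have := List.mem_of_mem_take hi
    simpa [List.mem_insertionSort] using this

/-- The number of triples that encode the events of a transcript. -/
def Transcript.size {N : ℕ} (τ : Transcript N) : ℕ := ((τ.map Prod.fst).flatMap Event.triples).length

lemma Transcript.length_le_size {N : ℕ} (τ : Transcript N) : τ.length ≤ Transcript.size τ := by
  have h1 : ∀ e : Event, 1 ≤ e.triples.length := by
    intro e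
    match e with
    | .fresh => simp [Event.triples]
    | .op .add a b => simp [Event.triples]
    | .op .sub a b => simp [Event.triples]
    | .op .mul a b => simp [Event.triples]
    | .op .rot a b => simp [Event.triples]
    | .op .const a b => simp [Event.triples]
    | .draw r => simp [Event.triples]
    | .answer hs r => simp [Event.triples]
  induction τ with
  | nil => simp
  | cons e τ ih =>
    have := h1 e.1
    simp [Transcript.size] at ih ⊢
    omega

/-- Transcripts of bounded protocols are short and contain only short numbers. -/
lemma Bounded.trace_spec {P : Params} (x : Input P) {B : ℕ} {α : Type} {Q : α → Prop} {p : Proto α}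
    {c : ℕ} (h : Bounded B Q p c) (st : List (Fin P.slots → ℝ)) (hst : st.length + c ≤ B) :
    ∀ τ ∈ (trace x p st).support, Transcript.size τ ≤ c ∧
      ∀ e ∈ τ, ∀ v ∈ e.1.words, Nat.size v ≤ B + c + 4 := by
  have hs : ∀ k, Nat.size k ≤ k := size_le_self
  have hlit : ∀ k, k ≤ 10 → Nat.size k ≤ 4 := fun k hk => Nat.size_le.2 (by norm_num; omega)
  induction h generalizing st with
  | done ha => simp [trace, Transcript.size]
  | @draw v n k c c' hv hk hc ih =>
    intro τ hτ
    simp only [trace, PMF.mem_support_bind_iff, PMF.mem_support_map_iff] at hτ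
    obtain ⟨r, -, σ, hσ, rfl⟩ := hτ
    obtain ⟨h1, h2⟩ := ih r st (by omega) σ hσ
    have hr : v = true → Nat.size (r : ℕ) ≤ B := fun h => (hs r).trans (by have := hv h; omega)
    cases v with
    | false => exact ⟨by simpa using h1.trans (by omega), fun e he w hw =>
        (h2 e (by simpa using he) w hw).trans (by omega)⟩
    | true =>
      constructor
      · simp [Transcript.size, Event.triples] at h1 ⊢
        omega
      · intro e he w hw
        simp only [if_true, List.singleton_append, List.mem_cons] at he
        rcases he with rfl | he
        · simp only [Event.words, List.mem_cons, List.not_mem_nil, or_false] at hw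
          rcases hw with rfl | rfl | rfl
          · exact (hlit 7 (by omega)).trans (by omega)
          · exact (hr rfl).trans (by omega)
          · exact (hlit 0 (by omega)).trans (by omega)
        · exact (h2 e he w hw).trans (by omega)
  | @fresh src k c c' hk hc ih =>
    intro τ hτ
    simp only [trace, PMF.mem_support_map_iff] at hτ
    obtain ⟨σ, hσ, rfl⟩ := hτ
    obtain ⟨h1, h2⟩ := ih st.length ((hs _).trans (by omega)) _ (by simp; omega) σ hσ
    constructor
    · simp [Transcript.size, Event.triples] at h1 ⊢
      omega
    · intro e he v hv
      rw [List.mem_cons] at he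
      rcases he with rfl | he
      · simp only [Event.words, List.mem_cons, List.not_mem_nil, or_false] at hv
        exact (hlit v (by omega)).trans (by omega)
      · exact (h2 e he v hv).trans (by omega)
  | @op o a b k c c' ha hb hk hc ih =>
    intro τ hτ
    simp only [trace, PMF.mem_support_map_iff] at hτ
    obtain ⟨σ, hσ, rfl⟩ := hτ
    obtain ⟨h1, h2⟩ := ih st.length ((hs _).trans (by omega)) _ (by simp; omega) σ hσ
    constructor
    · have : (Event.op o a b).triples.length = 1 := by cases o <;> rfl
      simp [Transcript.size, this] at h1 ⊢
      omega
    · intro e he v hv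
      rw [List.mem_cons] at he
      rcases he with rfl | he
      · have : v ≤ 10 ∨ v = a ∨ v = b := by
          cases o <;> simp [Event.words] at hv <;> omega
        rcases this with h | rfl | rfl
        · exact (hlit v h).trans (by omega)
        · omega
        · omega
      · exact (h2 e he v hv).trans (by omega)
  | @peek hs' m k c hk ih =>
    have h := smallest_spec (hs'.map fun h => (plainWorld x).value ((plainWorld x).look st h)) m
    rw [List.length_map] at h
    exact ih _ h.1 h.2 st hst
  | @tell hs' r k c c' h' hr hk hc ih =>
    intro τ hτ
    simp only [trace, PMF.mem_support_map_iff] at hτ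
    obtain ⟨σ, hσ, rfl⟩ := hτ
    obtain ⟨h1, h2⟩ := ih st (by omega) σ hσ
    constructor
    · simp [Transcript.size, Event.triples] at h1 ⊢
      omega
    · intro e he v hv
      rw [List.mem_cons] at he
      rcases he with rfl | he
      · simp only [Event.words, List.mem_cons, List.not_mem_nil, or_false, List.mem_append,
          List.mem_flatMap] at hv
        have h8 := hlit 8 (by omega)
        have h9 := hlit 9 (by omega)
        have h10 := hlit 10 (by omega)
        have h0 := hlit 0 (by omega)
        have l1 := hs hs'.length
        have l2 := hs r.length
        rcases hv with ((rfl | rfl | rfl) | ⟨a, ha, rfl | rfl | rfl⟩) | ⟨a, ha, rfl | rfl | rfl⟩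
        · omega
        · omega
        · omega
        · omega
        · have := h' _ ha; omega
        · omega
        · omega
        · have := hr _ ha; omega
        · omega
      · exact (h2 e he v hv).trans (by omega)

namespace Bounded

variable {B : ℕ} {α β : Type} {Q : α → Prop} {R : β → Prop}

lemma mono {p : Proto α} {c c' : ℕ} (h : Bounded B Q p c) (hc : c ≤ c') : Bounded B Q p c' := by
  induction h generalizing c' with
  | done ha => exact .done ha
  | draw hv hk h ih => exact .draw hv hk (h.trans hc)
  | fresh hk h ih => exact .fresh hk (h.trans hc)
  | op ha hb hk h ih => exact .op ha hb hk (h.trans hc)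
  | peek hk ih => exact .peek fun r h1 h2 => ih r h1 h2 hc
  | tell h1 h2 hk h ih => exact .tell h1 h2 hk (h.trans hc)

lemma bind {p : Proto α} {f : α → Proto β} {c₁ c₂ c : ℕ} (hp : Bounded B Q p c₁)
    (hf : ∀ a, Q a → Bounded B R (f a) c₂) (hc : c₁ + c₂ ≤ c) : Bounded B R (p >>= f) c := by
  change Bounded B R (p.bind f) c
  induction hp generalizing c with
  | done ha => exact (hf _ ha).mono (by omega)
  | draw hv hk h ih => exact .draw hv (fun r => ih r le_rfl) (by omega)
  | fresh hk h ih => exact .fresh (fun r hr => ih r hr le_rfl) (by omega)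
  | op ha hb hk h ih => exact .op ha hb (fun r hr => ih r hr le_rfl) (by omega)
  | peek hk ih => exact .peek fun r h1 h2 => ih r h1 h2 hc
  | tell h1 h2 hk h ih => exact .tell h1 h2 (ih le_rfl) (by omega)

lemma imp {p : Proto α} {Q' : α → Prop} {c : ℕ} (h : Bounded B Q p c) (hQ : ∀ a, Q a → Q' a) :
    Bounded B Q' p c := by
  induction h with
  | done ha => exact .done (hQ _ ha)
  | draw hv hk h ih => exact .draw hv ih h
  | fresh hk h ih => exact .fresh ih h
  | op ha hb hk h ih => exact .op ha hb ih h
  | peek hk ih => exact .peek ih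
  | tell h1 h2 hk h ih => exact .tell h1 h2 ih h

lemma pure {a : α} {c : ℕ} (h : Q a) : Bounded B Q (Pure.pure a : Proto α) c := .done h

/-- Rule for loops, with an invariant that may depend on the number of rounds. -/
lemma foldlM {γ : Type} {f : β → γ → Proto β} {l : List γ} {c C : ℕ} (I : ℕ → β → Prop)
    (hf : ∀ i b a, a ∈ l → i < l.length → I i b → Bounded B (I (i + 1)) (f b a) c) {b : β}
    (hb : I 0 b) (hC : l.length * c ≤ C) : Bounded B (I l.length) (l.foldlM f b) C := by
  suffices H : ∀ (l' : List γ) (i : ℕ) (b : β), (∀ a ∈ l', a ∈ l) → i + l'.length = l.length →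
      I i b → Bounded B (I l.length) (l'.foldlM f b) (l'.length * c) from
    (H l 0 b (fun _ h => h) (by simp) hb).mono hC
  intro l'
  induction l' with
  | nil =>
    intro i b _ hi h
    simp only [List.length_nil, add_zero] at hi
    subst hi
    exact pure h
  | cons a l' ih =>
    intro i b hl hi h
    rw [List.length_cons] at hi
    rw [List.foldlM_cons]
    exact bind (hf i b a (hl a (by simp)) (by omega) h)
      (fun b' hb' => ih (i + 1) b' (fun a ha => hl a (List.mem_cons_of_mem _ ha)) (by omega) hb')
      (by rw [List.length_cons, add_mul]; omega)

lemma mapM' {γ : Type} {f : γ → Proto β} {l : List γ} {c C : ℕ}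
    (hf : ∀ a ∈ l, Bounded B R (f a) c) (hC : l.length * c ≤ C) :
    Bounded B (fun r => r.length = l.length ∧ ∀ y ∈ r, R y) (l.mapM' f) C := by
  refine mono ?_ hC
  clear hC
  induction l with
  | nil => exact pure (by simp)
  | cons a l ih =>
    rw [List.mapM'_cons]
    refine bind (hf a (by simp)) (fun y hy => bind (ih fun a ha => hf a (List.mem_cons_of_mem _ ha))
      (c₂ := 0) (fun ys hys => pure ?_) le_rfl) (by rw [List.length_cons, add_mul]; omega)
    simp [hys.1, hy]
    exact hys.2

lemma forM {γ : Type} {f : γ → Proto Unit} {l : List γ} {c C : ℕ}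
    (hf : ∀ a ∈ l, Bounded B (fun _ => True) (f a) c) (hC : l.length * c ≤ C) :
    Bounded B (fun _ => True) (l.forM f) C := by
  refine mono ?_ hC
  clear hC
  induction l with
  | nil => exact pure trivial
  | cons a l ih =>
    exact bind (hf a (by simp)) (fun _ _ => ih fun a ha => hf a (List.mem_cons_of_mem _ ha))
      (by rw [List.length_cons, add_mul]; omega)

end Bounded

/-- All members of a list of addresses have at most `B` bits. -/
def Short (B : ℕ) (l : List ℕ) : Prop := ∀ h ∈ l, Nat.size h ≤ B

lemma Short.getD {B : ℕ} {l : List ℕ} (h : Short B l) (i : ℕ) : Nat.size (l.getD i 0) ≤ B := by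
  rcases lt_or_ge i l.length with hi | hi
  · rw [List.getD_eq_getElem _ _ hi]
    exact h _ (List.getElem_mem hi)
  · rw [List.getD_eq_default _ _ hi]
    simp

lemma bounded_homOp {B : ℕ} {o : Op} {a b : ℕ} (ha : Nat.size a ≤ B) (hb : Nat.size b ≤ B) :
    Bounded B (fun h => Nat.size h ≤ B) (homOp o a b) 1 :=
  .op ha hb (fun _ h => .done h) le_rfl

lemma bounded_upload {B : ℕ} (src : Source) :
    Bounded B (fun h => Nat.size h ≤ B) (upload src) 1 :=
  .fresh (fun _ h => .done h) le_rfl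

lemma bounded_tell {B : ℕ} {hs r : List ℕ} (hhs : Short B hs)
    (hr : ∀ i ∈ r, Nat.size i ≤ B + hs.length) :
    Bounded B (fun _ => True) (tell hs r) (1 + hs.length + r.length) :=
  .tell (c := 0) hhs hr (.done trivial) (by omega)

lemma bounded_peek {B : ℕ} {hs : List ℕ} {m : ℕ} :
    Bounded B (fun r => r.length ≤ m ∧ ∀ i ∈ r, i < hs.length) (peek hs m) 0 :=
  .peek fun _ h1 h2 => .done ⟨h1, h2⟩

lemma bounded_pick {B : ℕ} {visible : Bool} {m : ℕ} {l : List ℕ}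
    (hv : visible = true → l.length ≤ B) :
    Bounded B (fun r => r.length ≤ m ∧ ∀ i ∈ r, i ∈ l) (pick visible m l) m := by
  induction m generalizing l with
  | zero => exact Bounded.pure (by simp)
  | succ m ih =>
    cases l with
    | nil => exact Bounded.pure (by simp)
    | cons x xs =>
      refine .draw (c := m) (fun h => by have := hv h; simp at this; omega) (fun r => ?_) le_rfl
      have hr : (r : ℕ) < (x :: xs).length := r.2
      refine Bounded.bind (ih (l := (x :: xs).eraseIdx r) fun h => ?_) (c₂ := 0)
        (fun rest h => Bounded.pure ?_) le_rfl
      · have := hv h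
        rw [List.length_eraseIdx_of_lt hr]
        omega
      · refine ⟨by simp [h.1], fun i hi => ?_⟩
        rw [List.mem_cons] at hi
        rcases hi with rfl | hi
        · rw [List.getD_eq_getElem _ _ hr]
          exact List.getElem_mem hr
        · exact List.mem_of_mem_eraseIdx (h.2 i hi)

lemma bounded_askNearest {B : ℕ} {real : Bool} {hs : List ℕ} {m : ℕ} (hhs : Short B hs) :
    Bounded B (fun r => r.length ≤ m ∧ ∀ i ∈ r, i < hs.length) (askNearest real hs m)
      (1 + hs.length + 2 * m) := by
  unfold askNearest
  have h : ∀ r : List ℕ, (r.length ≤ m ∧ ∀ i ∈ r, i < hs.length) →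
      Bounded B (fun r => r.length ≤ m ∧ ∀ i ∈ r, i < hs.length) (do tell hs r; return r)
        (1 + hs.length + m) := by
    intro r hr
    refine Bounded.bind (bounded_tell hhs fun i hi => ?_) (c₂ := 0)
      (fun _ _ => Bounded.pure hr) ?_
    · exact (size_le_self i).trans (by have := hr.2 i hi; omega)
    · have := hr.1
      omega
  dsimp only
  split_ifs
  · exact Bounded.bind bounded_peek h (by omega)
  · refine Bounded.bind (bounded_pick (by simp)) (fun r hr => h r ⟨hr.1, fun i hi => ?_⟩)
      (by omega)
    simpa using hr.2 i hi

/-- All the public parameters that govern the length of the protocol are at most `M`. -/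
structure Params.AtMost (P : Params) (M : ℕ) : Prop where
  logSlots : P.logSlots ≤ M
  scale : Nat.size P.scale ≤ M
  size : P.size ≤ M
  queries : P.queries ≤ M
  clusters : P.clusters ≤ M
  iters : P.iters ≤ M
  recip : P.recip.length ≤ M
  coeff : ∀ c ∈ P.recip, Nat.size c.natAbs ≤ M
  maxLayer : P.maxLayer ≤ M
  degree : P.degree ≤ M
  searchDepth : P.searchDepth ≤ M
  probes : P.probes ≤ M
  topK : P.topK ≤ M
  rho : ⌈P.rho⌉₊ ≤ M
  padLength : P.padLength ≤ M

section Costs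

variable (M g : ℕ)

/-- Bound for the number of triples in `nearest` with at most `L` candidates, if all parameters are at
most `M`. -/
def nearestCost (L : ℕ) : ℕ := L * (3 + 2 * M) + 1 + 2 * M

/-- Bound for the number of triples in `greedy` on a graph with at most `g` links. -/
def greedyCost : ℕ := M * nearestCost M ((M + 1) * (1 + g))

/-- Bound for the number of triples in `insert` into a graph with at most `g` links. -/
def insertCost : ℕ := M + ((M + 1) * nearestCost M (1 + g) + (M + 1) * greedyCost M g)

/-- Bound for the number of triples in `kMeansStep`. -/
def kMeansCost : ℕ := M * (M * (3 + 2 * M) + 3) + M * (4 + 5 * M)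

/-- Bound for the number of links of the HNSW graphs: each of at most `M` insertions adds two links for
each of at most `M + 1` neighbors in each of at most `M + 1` layers. -/
def linkBound : ℕ := M * (2 * (M + 1) ^ 2)

/-- Bound for the number of triples in `setup`. -/
def setupCost : ℕ :=
  M + (M + (M + (M * kMeansCost M + (M * (M * insertCost M (linkBound M)) + (1 + M)))))

/-- Bound for the number of triples in `traverse` on a graph with at most `g` links. -/
def traverseCost : ℕ :=
  (M + 1) * nearestCost M (1 + g) + (greedyCost M g + (M * nearestCost M (1 + g) +
    (M * (2 + 2 * M) + (1 + M))))

/-- Bound for the number of triples in `retrieve`. -/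
def retrieveCost : ℕ :=
  1 + (2 + (M * (2 + 2 * M) + (M * M + ((M + M * M) + ((1 + M + (M + M * M)) +
    (M + M * M) * traverseCost M (linkBound M))))))

/-- Bound for the number of triples in the whole protocol. -/
def pragCost : ℕ := setupCost M + M * (setupCost M + retrieveCost M)

end Costs

variable {B M : ℕ} {P : Params}

lemma bounded_homIP (hP : P.AtMost M) (hMB : M ≤ B) {a b : ℕ} (ha : Nat.size a ≤ B)
    (hb : Nat.size b ≤ B) : Bounded B (fun h => Nat.size h ≤ B) (homIP P a b) (1 + 2 * M) := by
  unfold homIP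
  refine Bounded.bind (bounded_homOp ha hb) (c₂ := 2 * M) (fun p hp => ?_) le_rfl
  refine Bounded.foldlM (c := 2) (fun _ h => Nat.size h ≤ B) (fun i b a ha hi hb => ?_) hp ?_
  · refine Bounded.bind (bounded_homOp hb ?_) (c₂ := 1) (fun r hr => bounded_homOp hb hr) le_rfl
    have := hP.logSlots
    rw [List.mem_range] at ha
    exact (size_le_self a).trans (by omega)
  · have := hP.logSlots
    rw [List.length_range]
    omega

lemma bounded_homDist (hP : P.AtMost M) (hMB : M ≤ B) {a b : ℕ} (ha : Nat.size a ≤ B)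
    (hb : Nat.size b ≤ B) : Bounded B (fun h => Nat.size h ≤ B) (homDist P a b) (2 + 2 * M) :=
  Bounded.bind (bounded_homOp ha hb) (fun _ hx => bounded_homIP hP hMB hx hx) (by omega)

lemma bounded_homNorm (hP : P.AtMost M) (hMB : M ≤ B) {a b : ℕ} (ha : Nat.size a ≤ B)
    (hb : Nat.size b ≤ B) : Bounded B (fun h => Nat.size h ≤ B) (homNorm P a b) (2 + 3 * M) := by
  unfold homNorm
  refine Bounded.bind (bounded_homOp (by simp) (by simp)) (c₂ := 1 + 3 * M) (fun z hz => ?_) (by omega)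
  refine Bounded.bind (Q := fun h => Nat.size h ≤ B) (c₁ := 3 * M) (c₂ := 1) ?_
    (fun i hi => bounded_homOp ha hi) (by omega)
  rw [List.foldrM]
  refine Bounded.foldlM (c := 3) (fun _ h => Nat.size h ≤ B) (fun i acc c hc hi hacc => ?_) hz ?_
  · have h1 := hP.coeff c (by simpa using hc)
    refine Bounded.bind (bounded_homOp hacc hb) (c₂ := 2) (fun t ht => ?_) le_rfl
    refine Bounded.bind (bounded_homOp ?_ ?_) (c₂ := 1) (fun k hk => bounded_homOp ht hk) le_rfl
    · exact (Nat.size_le_size (by omega)).trans (h1.trans hMB)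
    · exact (Nat.size_le_size (by omega)).trans (h1.trans hMB)
  · have := hP.recip
    rw [List.length_reverse]
    omega

lemma bounded_centroid (hP : P.AtMost M) (hMB : M ≤ B) {hs : List ℕ} (hhs : Short B hs)
    (hlen : hs.length ≤ M) :
    Bounded B (fun h => Nat.size h ≤ B) (centroid P hs) (4 + 5 * M) := by
  unfold centroid
  refine Bounded.bind (bounded_homOp (by simp) (by simp)) (c₂ := 3 + 5 * M) (fun z hz => ?_) (by omega)
  refine Bounded.bind (bounded_homOp (hP.scale.trans hMB) (by simp)) (c₂ := 2 + 5 * M)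
    (fun one h1 => ?_) (by omega)
  refine Bounded.bind (Bounded.foldlM (c := 1) (C := M) (fun _ h => Nat.size h ≤ B)
    (fun i b a ha hi hb => bounded_homOp hb (hhs a ha)) hz (by omega)) (c₂ := 2 + 4 * M)
    (fun sum hsum => ?_) (by omega)
  refine Bounded.bind (Bounded.foldlM (c := 1) (C := M) (fun _ h => Nat.size h ≤ B)
    (fun i b a ha hi hb => bounded_homOp hb h1) hz (by omega)) (c₂ := 2 + 3 * M)
    (fun count hc => bounded_homNorm hP hMB hsum hc) (by omega)

lemma bounded_nearest (hP : P.AtMost M) (hMB : M ≤ B) {real : Bool} {vecs : List ℕ}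
    (hvecs : Short B vecs) {q : ℕ} (hq : Nat.size q ≤ B) {cands : List ℕ} {L : ℕ}
    (hL : cands.length ≤ L) {m : ℕ} (hm : m ≤ M) :
    Bounded B (fun r => r.length ≤ m) (nearest P real vecs q cands m) (nearestCost M L) := by
  unfold nearest
  have h := Nat.mul_le_mul_right (3 + 2 * M) hL
  refine Bounded.bind (Bounded.mapM' (fun v _ => bounded_homDist hP hMB hq (hvecs.getD v)) le_rfl)
    (c₂ := 1 + cands.length + 2 * m) (fun ds hds => ?_) ?_
  · refine Bounded.bind (bounded_askNearest hds.2) (c₂ := 0) (fun r hr => Bounded.pure ?_) ?_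
    · simpa using hr.1
    · rw [hds.1]
      omega
  · unfold nearestCost
    nlinarith

/-- The HNSW graph has at most `g` links, and layers up to `M`. -/
def Graph.Within (M g : ℕ) (G : Graph) : Prop := G.links.length ≤ g ∧ G.top ≤ M

lemma length_dedup_le (l : List ℕ) : l.dedup.length ≤ l.length :=
  (List.dedup_sublist l).length_le

lemma Graph.Within.length_neighbors {g : ℕ} {G : Graph} (hG : G.Within M g) (l u : ℕ) :
    (G.neighbors l u).length ≤ g := by
  unfold Graph.neighbors
  refine (length_dedup_le _).trans ?_
  rw [List.length_map]
  exact (List.length_filter_le _ _).trans hG.1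

lemma bounded_descend (hP : P.AtMost M) (hMB : M ≤ B) (hM : 1 ≤ M) {real : Bool} {vecs : List ℕ}
    (hvecs : Short B vecs) {q : ℕ} (hq : Nat.size q ≤ B) {g : ℕ} {G : Graph} (hG : G.Within M g)
    (ep l : ℕ) :
    Bounded B (fun _ => True) (descend P real vecs q G ep l) (nearestCost M (1 + g)) := by
  unfold descend
  refine Bounded.bind (bounded_nearest hP hMB hvecs hq (L := 1 + g) ?_ hM) (c₂ := 0)
    (fun r hr => Bounded.pure trivial) le_rfl
  refine (length_dedup_le _).trans ?_
  have := hG.length_neighbors l ep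
  rw [List.length_cons]
  omega

/-- The bound `M + 1` instead of `M` covers the initial pool, which may be larger than `degree = 0`. -/
lemma bounded_greedy (hP : P.AtMost M) (hMB : M ≤ B) {real : Bool} {vecs : List ℕ}
    (hvecs : Short B vecs) {q : ℕ} (hq : Nat.size q ≤ B) {g : ℕ} {G : Graph} (hG : G.Within M g)
    (ep l : ℕ) :
    Bounded B (fun r => r.length ≤ M + 1) (greedy P real vecs q G ep l) (greedyCost M g) := by
  unfold greedy
  refine Bounded.foldlM (c := nearestCost M ((M + 1) * (1 + g))) (fun _ (r : List ℕ) => r.length ≤ M + 1)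
    (fun i pool _ _ _ hpool => ?_) (by simp) ?_
  · refine Bounded.imp (bounded_nearest hP hMB hvecs hq ?_ hP.degree) fun r hr =>
      hr.trans (hP.degree.trans (Nat.le_succ M))
    refine (length_dedup_le _).trans ?_
    have h1 : (pool.flatMap (G.neighbors l)).length ≤ pool.length * g := by
      rw [List.length_flatMap]
      simpa using List.sum_le_card_nsmul (pool.map fun u => (G.neighbors l u).length) g
        (by simpa using fun u _ => hG.length_neighbors l u)
    have h2 := Nat.mul_le_mul_right (1 + g) hpool
    rw [List.length_append]
    nlinarith
  · rw [List.length_range]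
    exact Nat.mul_le_mul_right _ hP.searchDepth

lemma bounded_randomLayer (hP : P.AtMost M) (hMB : M ≤ B) (l : ℕ) :
    Bounded B (fun r => r ≤ l) (randomLayer P l) l := by
  induction l with
  | zero => exact Bounded.pure le_rfl
  | succ l ih =>
    refine .draw (c := l) (fun _ => by have := hP.degree; omega) (fun r => ?_) le_rfl
    split_ifs
    · exact Bounded.bind ih (c₂ := 0) (fun t ht => Bounded.pure (by omega)) le_rfl
    · exact Bounded.pure (by omega)

/-- The cost is bounded in terms of the final number `g'` of links, the growth in terms of the present
number `g`. -/
lemma bounded_insert (hP : P.AtMost M) (hMB : M ≤ B) (hM : 1 ≤ M) {vecs : List ℕ}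
    (hvecs : Short B vecs) {g g' : ℕ} {G : Graph} (hG : G.Within M g) (hg : g ≤ g') (v : ℕ) :
    Bounded B (Graph.Within M (g + 2 * (M + 1) ^ 2)) (insert P vecs G v) (insertCost M g') := by
  have hG' : G.Within M g' := ⟨hG.1.trans hg, hG.2⟩
  unfold insert
  refine Bounded.bind ((bounded_randomLayer hP hMB _).mono hP.maxLayer) (fun layer hl => ?_) le_rfl
  have hlayer : layer ≤ M := hl.trans hP.maxLayer
  split
  · exact Bounded.pure ⟨by simp, hlayer⟩
  · rename_i e _
    refine Bounded.bind (Bounded.foldlM (c := nearestCost M (1 + g')) (C := (M + 1) * nearestCost M (1 + g'))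
      (fun _ _ => True)
      (fun i b a ha hi hb => bounded_descend hP hMB hM hvecs (hvecs.getD v) hG' b a) trivial ?_)
      (c₂ := (M + 1) * greedyCost M g') (fun ep _ => ?_) le_rfl
    · refine Nat.mul_le_mul_right _ ?_
      rw [List.length_reverse]
      refine (List.length_filter_le _ _).trans ?_
      have := hG.2
      simpa using this
    · refine Bounded.bind (Bounded.foldlM (c := greedyCost M g') (C := (M + 1) * greedyCost M g')
        (fun i w => w.1.length ≤ g + i * (2 * (M + 1))) (fun i w l hl hi hw => ?_) ?_ ?_)
        (c₂ := 0) (fun out hout => Bounded.pure ⟨?_, ?_⟩) le_rfl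
      · refine Bounded.bind (bounded_greedy hP hMB hvecs (hvecs.getD v) hG' w.2 l) (c₂ := 0)
          (fun near hnear => Bounded.pure ?_) le_rfl
        have : (near.flatMap fun u => [(l, v, u), (l, u, v)]).length = near.length * 2 := by
          simp [List.length_flatMap]
        simp only [List.length_append, this]
        rw [add_mul]
        omega
      · simpa using hG.1
      · refine Nat.mul_le_mul_right _ ?_
        simp
        omega
      · refine (show out.1.length ≤ _ from hout).trans ?_
        have : (List.range (min layer G.top + 1)).reverse.length ≤ M + 1 := by simp; omega
        have := Nat.mul_le_mul_right (2 * (M + 1)) this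
        nlinarith
      · exact max_le hG.2 hlayer

lemma bounded_kMeansStep (hP : P.AtMost M) (hMB : M ≤ B) {vecs cents : List ℕ}
    (hvecs : Short B vecs) (hcents : Short B cents) (hv : vecs.length ≤ M) (hc : cents.length ≤ M) :
    Bounded B (fun w => w.2.length ≤ M ∧ Short B w.2) (kMeansStep P vecs cents) (kMeansCost M) := by
  unfold kMeansStep
  refine Bounded.bind (c₁ := M * (M * (3 + 2 * M) + 3)) (c₂ := M * (4 + 5 * M))
    (Bounded.mapM' (R := fun _ => True) (c := M * (3 + 2 * M) + 3) (fun h hh => ?_)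
      (Nat.mul_le_mul_right _ hv)) (fun assign _ => ?_) le_rfl
  · refine Bounded.bind (Bounded.mapM' (fun c hc => bounded_homDist hP hMB (hvecs h hh) (hcents c hc))
      (Nat.mul_le_mul_right _ hc)) (c₂ := M + 3) (fun ds hds => ?_) (by nlinarith)
    refine Bounded.bind (bounded_askNearest hds.2) (c₂ := 0) (fun r _ => Bounded.pure trivial) ?_
    rw [hds.1]
    omega
  · refine Bounded.bind (Bounded.mapM' (R := fun h => Nat.size h ≤ B) (c := 4 + 5 * M) (fun j _ => ?_)
      (C := M * (4 + 5 * M)) ?_) (c₂ := 0) (fun new hnew => Bounded.pure ⟨?_, hnew.2⟩) le_rfl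
    · dsimp only
      split_ifs
      · exact Bounded.pure (hcents.getD j)
      · refine bounded_centroid hP hMB ?_ ?_
        · intro h hh
          rw [List.mem_map] at hh
          obtain ⟨w, hw, rfl⟩ := hh
          exact hvecs _ (List.of_mem_zip (List.mem_of_mem_filter hw)).1
        · rw [List.length_map]
          refine (List.length_filter_le _ _).trans ?_
          rw [List.length_zip]
          omega
    · rw [List.length_range]
      exact Nat.mul_le_mul_right _ hc
    · rw [hnew.1, List.length_range]
      exact hc

/-- What the length of a query depends on: the bit length of the addresses, the number of clusters, and
the size of the graphs. -/
def Index.Within (B M : ℕ) (I : Index) : Prop :=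
  Short B I.vecs ∧ Short B I.cents ∧ I.cents.length ≤ M ∧
    ∀ G ∈ I.graphs, G.Within M (linkBound M)

lemma bounded_setup (hP : P.AtMost M) (hMB : M ≤ B) (hM : 1 ≤ M) :
    Bounded B (Index.Within B M) (setup P) (setupCost M) := by
  unfold setup setupCost
  have hsize := hP.size
  refine Bounded.bind (Bounded.mapM' (c := 1) (C := M) (fun i _ => bounded_upload (.data i)) (by simpa))
    (fun vecs hvecs => ?_) le_rfl
  refine Bounded.bind ((bounded_pick (fun _ => by simp; omega)).mono hP.clusters) (fun init hinit => ?_) le_rfl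
  have hlen : init.length ≤ M := hinit.1.trans hP.clusters
  refine Bounded.bind (Bounded.mapM' (c := 1) (C := M) (fun i _ => bounded_upload (.data i)) (by simpa))
    (fun cents hcents => ?_) le_rfl
  refine Bounded.bind (Bounded.foldlM (c := kMeansCost M) (C := M * kMeansCost M)
    (fun _ (w : List ℕ × List ℕ) => w.2.length ≤ M ∧ Short B w.2)
    (fun i w _ _ _ hw => bounded_kMeansStep hP hMB hvecs.2 hw.2 (by simpa [hvecs.1]) hw.1)
    ⟨by simpa [hcents.1], hcents.2⟩ (by simpa using Nat.mul_le_mul_right _ hP.iters))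
    (fun out hout => ?_) le_rfl
  refine Bounded.bind (Bounded.mapM' (R := Graph.Within M (linkBound M)) (c := M * insertCost M (linkBound M))
    (C := M * (M * insertCost M (linkBound M))) (fun j _ => ?_) ?_) (fun graphs hgraphs => ?_) le_rfl
  · have hl : ((List.range P.size).filter fun i => out.1.getD i 0 = j).length ≤ M :=
      (List.length_filter_le _ _).trans (by simpa)
    refine (Bounded.foldlM (c := insertCost M (linkBound M))
      (fun i => Graph.Within M (i * (2 * (M + 1) ^ 2))) (fun i G v _ hi hG => ?_) ?_
      (Nat.mul_le_mul_right _ hl)).imp fun G hG => ⟨hG.1.trans (Nat.mul_le_mul_right _ hl), hG.2⟩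
    · rw [add_mul, one_mul]
      exact bounded_insert hP hMB hM hvecs.2 hG (Nat.mul_le_mul_right _ (by omega)) v
    · exact ⟨by simp, by simp⟩
  · rw [List.length_range]
    exact Nat.mul_le_mul_right _ hout.1
  · refine Bounded.bind (bounded_tell hout.2 (by simp)) (c₂ := 0)
      (fun _ _ => Bounded.pure ⟨hvecs.2, hout.2, hout.1, hgraphs.2⟩) ?_
    have := hout.1
    simp
    omega

lemma bounded_traverse (hP : P.AtMost M) (hMB : M ≤ B) (hM : 1 ≤ M) {real : Bool} {vecs : List ℕ}
    (hvecs : Short B vecs) {q : ℕ} (hq : Nat.size q ≤ B) {g : ℕ} {G : Graph} (hG : G.Within M g) :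
    Bounded B (fun _ => True) (traverse P real vecs q G) (traverseCost M g) := by
  unfold traverse traverseCost
  split
  · exact (bounded_tell (by simp [Short]) (by simp)).mono (by simp; omega)
  · rename_i e _
    refine Bounded.bind (Bounded.foldlM (c := nearestCost M (1 + g)) (C := (M + 1) * nearestCost M (1 + g))
      (fun _ _ => True)
      (fun i b a ha hi hb => bounded_descend hP hMB hM hvecs hq hG b a) trivial ?_)
      (fun ep _ => ?_) le_rfl
    · refine Nat.mul_le_mul_right _ ?_
      rw [List.length_reverse]
      refine (List.length_filter_le _ _).trans ?_
      have := hG.2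
      simpa using this
    refine Bounded.bind (bounded_greedy hP hMB hvecs hq hG ep 0) (fun pool _ => ?_) le_rfl
    refine Bounded.bind (Bounded.foldlM (c := nearestCost M (1 + g)) (C := M * nearestCost M (1 + g))
      (fun _ _ => True) (fun i b a ha hi hb => ?_) trivial ?_) (fun _ _ => ?_) le_rfl
    · refine Bounded.bind (bounded_nearest hP hMB hvecs hq ?_ hM) (c₂ := 0)
        (fun _ _ => Bounded.pure trivial) le_rfl
      have := hG.length_neighbors 0 b
      omega
    · refine Nat.mul_le_mul_right _ ?_
      have := hP.padLength
      simp
      omega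
    have hl : (pool.take P.topK).length ≤ M := by
      have := hP.topK
      simp
      omega
    refine Bounded.bind (Bounded.mapM' (fun v _ => bounded_homDist hP hMB hq (hvecs.getD v))
      (Nat.mul_le_mul_right _ hl)) (fun ds hds => ?_) le_rfl
    refine (bounded_tell hds.2 (by simp)).mono ?_
    rw [hds.1, List.length_nil]
    omega

lemma ceil_mul_le (ρ : ℝ) (n : ℕ) : ⌈ρ * n⌉₊ ≤ ⌈ρ⌉₊ * n := by
  rw [Nat.ceil_le]
  push_cast
  exact mul_le_mul_of_nonneg_right (Nat.le_ceil ρ) (Nat.cast_nonneg n)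

lemma bounded_retrieve (hP : P.AtMost M) (hMB : M ≤ B) (hM : 1 ≤ M) {I : Index}
    (hI : I.Within B M) (i : ℕ) :
    Bounded B (fun _ => True) (retrieve P I i) (retrieveCost M) := by
  obtain ⟨hvecs, hcents, hlen, hgraphs⟩ := hI
  unfold retrieve retrieveCost
  refine Bounded.bind (bounded_upload _) (fun q hq => ?_) le_rfl
  refine Bounded.bind (bounded_tell (by simp [Short]) ?_) (fun _ _ => ?_) le_rfl
  · have := size_le_self P.topK
    have := hP.topK
    simp
    omega
  refine Bounded.bind (Bounded.mapM' (fun c hc => bounded_homDist hP hMB hq (hcents c hc))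
    (Nat.mul_le_mul_right _ hlen)) (fun ds hds => ?_) le_rfl
  refine Bounded.bind bounded_peek (fun best hbest => ?_) (Nat.zero_add _).le
  -- The positions in `best`, and those of the dummy clusters, are numbers of clusters.
  have hb : best.length ≤ M := hbest.1.trans hP.probes
  have hdum : ⌈P.rho * best.length⌉₊ ≤ M * M :=
    (ceil_mul_le _ _).trans (Nat.mul_le_mul hP.rho hb)
  refine Bounded.bind (Bounded.mapM' (c := 1) (C := M * M)
    (fun _ _ => bounded_pick (m := 1) (l := List.range I.cents.length) (by simp))
    (by rw [List.length_range, mul_one]; exact hdum))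
    (fun dummies hd => ?_) le_rfl
  dsimp only
  set reqs := best.map (fun j => (j, true)) ++ dummies.map (fun j => (j.headD 0, false)) with hreqs
  have hrlen : reqs.length ≤ M + M * M := by
    have := hd.1
    simp [hreqs] at this ⊢
    omega
  have hreq : ∀ w ∈ reqs, w.1 ≤ ds.length := by
    intro w hw
    rw [hreqs, List.mem_append, List.mem_map, List.mem_map] at hw
    rcases hw with ⟨j, hj, rfl⟩ | ⟨j, hj, rfl⟩
    · exact (hbest.2 j hj).le
    · cases j with
      | nil => simp
      | cons a j =>
        have := (hd.2 _ hj).2 a (by simp)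
        rw [List.mem_range] at this
        rw [hds.1]
        exact this.le
  refine Bounded.bind ((bounded_pick (by simp)).mono hrlen) (fun order horder => ?_) le_rfl
  have hmix : ∀ w ∈ order.map fun t => reqs.getD t (0, false), w.1 ≤ ds.length := by
    intro w hw
    rw [List.mem_map] at hw
    obtain ⟨t, ht, rfl⟩ := hw
    have := horder.2 t ht
    rw [List.mem_range] at this
    rw [List.getD_eq_getElem _ _ this]
    exact hreq _ (List.getElem_mem this)
  refine Bounded.bind ((bounded_tell hds.2 ?_).mono ?_) (fun _ _ => ?_) le_rfl
  · intro j hj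
    rw [List.mem_map] at hj
    obtain ⟨w, hw, rfl⟩ := hj
    exact (size_le_self _).trans ((hmix w hw).trans (by omega))
  · have := horder.1
    rw [hds.1, List.length_map, List.length_map]
    omega
  · refine Bounded.forM (fun w _ => bounded_traverse hP hMB hM hvecs hq ?_) (Nat.mul_le_mul_right _ ?_)
    · rcases lt_or_ge w.1 I.graphs.length with h | h
      · rw [List.getD_eq_getElem _ _ h]
        exact hgraphs _ (List.getElem_mem h)
      · rw [List.getD_eq_default _ _ h]
        exact ⟨by simp, by simp⟩
    · have := horder.1
      rw [List.length_map]
      omega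

lemma bounded_pragII (hP : P.AtMost M) (hMB : M ≤ B) (hM : 1 ≤ M) :
    Bounded B (fun _ => True) (pragII P) (pragCost M) := by
  unfold pragII pragCost
  refine Bounded.bind (bounded_setup hP hMB hM) (fun I hI => ?_) le_rfl
  refine Bounded.bind (Bounded.foldlM (c := setupCost M + retrieveCost M) (fun _ => Index.Within B M)
    (fun _ I i _ _ hI => ?_) hI (C := M * (setupCost M + retrieveCost M)) ?_) (c₂ := 0)
    (fun _ _ => Bounded.pure trivial) le_rfl
  · have h : ∀ I, Index.Within B M I → Bounded B (Index.Within B M)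
        (do retrieve P I i; return I) (retrieveCost M) := fun I hI =>
      Bounded.bind (bounded_retrieve hP hMB hM hI i) (c₂ := 0) (fun _ _ => Bounded.pure hI) le_rfl
    dsimp only
    split_ifs
    · exact Bounded.bind (bounded_setup hP hMB hM) h le_rfl
    · exact (h I hI).mono (by omega)
  · rw [List.length_range]
    exact Nat.mul_le_mul_right _ hP.queries

lemma Params.atMost_complexity (P : Params) : P.AtMost P.complexity where
  logSlots := by
    have : P.logSlots < 2 ^ (P.logSlots + 1) := (Nat.lt_succ_self _).trans Nat.lt_two_pow_self
    unfold Params.complexity CKKS.N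
    omega
  scale := by unfold Params.complexity; omega
  size := by unfold Params.complexity; omega
  queries := by unfold Params.complexity; omega
  clusters := by unfold Params.complexity; omega
  iters := by unfold Params.complexity; omega
  recip := by unfold Params.complexity; omega
  coeff := fun c hc => by
    have := List.single_le_sum (by simp) _ (List.mem_map_of_mem (f := fun c : ℤ => Nat.size c.natAbs) hc)
    unfold Params.complexity
    omega
  maxLayer := by unfold Params.complexity; omega
  degree := by unfold Params.complexity; omega
  searchDepth := by unfold Params.complexity; omega
  probes := by unfold Params.complexity; omega
  topK := by unfold Params.complexity; omega
  rho := by unfold Params.complexity; omega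
  padLength := by unfold Params.complexity; omega

/-! ### Polynomial bounds and negligible functions -/

namespace PolyBounded

variable {f g : ℕ → ℕ}

lemma mono (hg : PolyBounded g) (h : ∀ s, f s ≤ g s) : PolyBounded f :=
  hg.imp fun _ hp s => (h s).trans (hp s)

lemma const (n : ℕ) : PolyBounded fun _ => n := ⟨Polynomial.C n, fun s => by simp⟩

lemma add (hf : PolyBounded f) (hg : PolyBounded g) : PolyBounded fun s => f s + g s := by
  obtain ⟨p, hp⟩ := hf
  obtain ⟨q, hq⟩ := hg
  exact ⟨p + q, fun s => by simpa using add_le_add (hp s) (hq s)⟩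

lemma mul (hf : PolyBounded f) (hg : PolyBounded g) : PolyBounded fun s => f s * g s := by
  obtain ⟨p, hp⟩ := hf
  obtain ⟨q, hq⟩ := hg
  exact ⟨p * q, fun s => by simpa using Nat.mul_le_mul (hp s) (hq s)⟩

lemma pow (hf : PolyBounded f) (n : ℕ) : PolyBounded fun s => f s ^ n := by
  obtain ⟨p, hp⟩ := hf
  exact ⟨p ^ n, fun s => by simpa using Nat.pow_le_pow_left (hp s) n⟩

lemma nearestCost {L : ℕ → ℕ} (hf : PolyBounded f) (hL : PolyBounded L) :
    PolyBounded fun s => nearestCost (f s) (L s) := by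
  unfold PRAG.nearestCost
  exact ((hL.mul ((const 3).add ((const 2).mul hf))).add (const 1)).add ((const 2).mul hf)

lemma greedyCost (hf : PolyBounded f) (hg : PolyBounded g) :
    PolyBounded fun s => greedyCost (f s) (g s) :=
  hf.mul (hf.nearestCost ((hf.add (const 1)).mul ((const 1).add hg)))

lemma insertCost (hf : PolyBounded f) (hg : PolyBounded g) :
    PolyBounded fun s => insertCost (f s) (g s) :=
  hf.add (((hf.add (const 1)).mul (hf.nearestCost ((const 1).add hg))).add
    ((hf.add (const 1)).mul (hf.greedyCost hg)))

lemma kMeansCost (hf : PolyBounded f) : PolyBounded fun s => kMeansCost (f s) :=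
  (hf.mul ((hf.mul ((const 3).add ((const 2).mul hf))).add (const 3))).add
    (hf.mul ((const 4).add ((const 5).mul hf)))

lemma linkBound (hf : PolyBounded f) : PolyBounded fun s => linkBound (f s) :=
  hf.mul ((const 2).mul ((hf.add (const 1)).pow 2))

lemma setupCost (hf : PolyBounded f) : PolyBounded fun s => setupCost (f s) :=
  hf.add (hf.add (hf.add ((hf.mul hf.kMeansCost).add
    ((hf.mul (hf.mul (hf.insertCost hf.linkBound))).add ((const 1).add hf)))))

lemma traverseCost (hf : PolyBounded f) (hg : PolyBounded g) :
    PolyBounded fun s => traverseCost (f s) (g s) :=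
  ((hf.add (const 1)).mul (hf.nearestCost ((const 1).add hg))).add ((hf.greedyCost hg).add
    ((hf.mul (hf.nearestCost ((const 1).add hg))).add
      ((hf.mul ((const 2).add ((const 2).mul hf))).add ((const 1).add hf))))

lemma retrieveCost (hf : PolyBounded f) : PolyBounded fun s => retrieveCost (f s) :=
  (const 1).add ((const 2).add ((hf.mul ((const 2).add ((const 2).mul hf))).add ((hf.mul hf).add
    ((hf.add (hf.mul hf)).add ((((const 1).add hf).add (hf.add (hf.mul hf))).add
      ((hf.add (hf.mul hf)).mul (hf.traverseCost hf.linkBound)))))))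

lemma pragCost (hf : PolyBounded f) : PolyBounded fun s => pragCost (f s) :=
  hf.setupCost.add (hf.mul (hf.setupCost.add hf.retrieveCost))

end PolyBounded

namespace Negligible

variable {f g : ℕ → ℝ}

lemma of_abs_le (hf : Negligible f) (h : ∀ s, |g s| ≤ |f s|) : Negligible g :=
  Asymptotics.SuperpolynomialDecay.trans_abs_le hf h

lemma poly_mul {n : ℕ → ℕ} (hn : PolyBounded n) (hf : Negligible f) :
    Negligible fun s => n s * f s := by
  obtain ⟨p, hp⟩ := hn
  refine of_abs_le (Asymptotics.SuperpolynomialDecay.polynomial_mul hf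
    (p.map (Nat.castRingHom ℝ))) fun s => ?_
  have h : (p.map (Nat.castRingHom ℝ)).eval (s : ℝ) = (p.eval s : ℕ) := by
    simp
  rw [abs_mul, abs_mul, h, Nat.abs_cast, Nat.abs_cast]
  exact mul_le_mul_of_nonneg_right (by exact_mod_cast hp s) (abs_nonneg _)

lemma add (hf : Negligible f) (hg : Negligible g) : Negligible fun s => f s + g s :=
  Asymptotics.SuperpolynomialDecay.add hf hg

end Negligible

lemma accepts_mem_Icc {N : ℕ} (p : PMF (Mem N)) : accepts p ∈ Set.Icc (0 : ℝ) 1 :=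
  ⟨ENNReal.toReal_nonneg, ENNReal.toReal_le_of_le_ofReal zero_le_one
    (by rw [ENNReal.ofReal_one]; exact PMF.coe_le_one _ _)⟩

lemma cpaGame_mem_Icc (K : CKKS) (A B : Prog) (bit : Bool) :
    cpaGame K A B bit ∈ Set.Icc (0 : ℝ) 1 := accepts_mem_Icc _

/-- IND-CPA security bounds the advantages of all adversaries of polynomially bounded size at the same
time, since nonuniform adversaries may be chosen separately, and nearly optimal, for every value of
the security parameter. -/
lemma INDCPA.exists_negligible_bound {K : ℕ → CKKS} (h : INDCPA K) {b : ℕ → ℕ}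
    (hb : PolyBounded b) :
    ∃ ε : ℕ → ℝ, Negligible ε ∧ (∀ s, 0 ≤ ε s) ∧ ∀ s (A B : Prog), cost A ≤ b s → cost B ≤ b s →
      |cpaGame (K s) A B false - cpaGame (K s) A B true| ≤ ε s := by
  let adv : ℕ → Prog × Prog → ℝ := fun s w =>
    |cpaGame (K s) w.1 w.2 false - cpaGame (K s) w.1 w.2 true|
  have hadv : ∀ s w, adv s w ≤ 1 := fun s w => by
    have h1 := cpaGame_mem_Icc (K s) w.1 w.2 false
    have h2 := cpaGame_mem_Icc (K s) w.1 w.2 true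
    exact abs_sub_le_iff.2 ⟨by linarith [h1.2, h2.1], by linarith [h2.2, h1.1]⟩
  let S : ℕ → Set ℝ := fun s => {r | ∃ w, cost w.1 ≤ b s ∧ cost w.2 ≤ b s ∧ adv s w = r}
  have hbdd : ∀ s, BddAbove (S s) := fun s => ⟨1, by rintro _ ⟨w, -, -, rfl⟩; exact hadv s w⟩
  have h0 : ∀ s, 0 ≤ sSup (S s) := fun s =>
    Real.sSup_nonneg (by rintro _ ⟨w, -, -, rfl⟩; exact abs_nonneg _)
  have hex : ∀ s, ∃ w : Prog × Prog, cost w.1 ≤ b s ∧ cost w.2 ≤ b s ∧ sSup (S s) ≤ 2 * adv s w := by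
    intro s
    rcases (h0 s).eq_or_lt with h | h
    · exact ⟨([], []), by simp, by simp, by rw [← h]; positivity⟩
    · have hne : (S s).Nonempty := ⟨_, ([], []), by simp, by simp, rfl⟩
      obtain ⟨_, ⟨w, h1, h2, rfl⟩, hw⟩ := exists_lt_of_lt_csSup hne (half_lt_self h)
      exact ⟨w, h1, h2, by linarith⟩
  -- The supremum need not be attained; adversaries that reach half of it suffice.
  choose w hA hB hw using hex
  refine ⟨fun s => sSup (S s), ?_, h0, fun s A B h1 h2 => le_csSup (hbdd s) ⟨(A, B), h1, h2, rfl⟩⟩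
  refine Negligible.of_abs_le (Negligible.poly_mul (.const 2)
    (h (fun s => (w s).1) (fun s => (w s).2) (hb.mono hA) (hb.mono hB))) fun s => ?_
  rw [abs_of_nonneg (h0 s), abs_of_nonneg (by positivity)]
  exact_mod_cast hw s

/-! ### Security -/

/-- The public words that belong to a list of events. -/
def Params.publicWords (P : Params) (es : List Event) : List ℕ :=
  (Leakage.mk P.size P.dim P.clusters P.topK es).words

/-- The real view differs from the replay of the transcript of the run on plaintexts at most by the
probability that the client once finds different orderings. -/
lemma detects_realView_near {P : Params} (x : Input P) (D : Prog) :
    |detects P D (realView P x) - ((trace x (pragII P) []).bind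
        (P.acceptance D P.publicWords) true).toReal| ≤
      ((P.keyGen.bind fun k =>
        agree (realWorld x k.1 k.2) (plainWorld x) (pragII P) [] []) false).toReal := by
  have h := fun k : PubKey P.N × RingElt P.N =>
    run_realWorld_near_replay x k.1 k.2 (pragII P) [] [] rfl fun o =>
      (exec P.toCKKS D (View.load ⟨k.1, o.2, P.publicWords o.1⟩)).map fun m => decide (m.reg 0 = 1)
  have h1 : detects P D (realView P x) = ((P.keyGen.bind fun k =>
      (run (realWorld x k.1 k.2) (pragII P) []).bind fun o =>
        (exec P.toCKKS D (View.load ⟨k.1, o.2, P.publicWords o.1⟩)).map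
          fun m => decide (m.reg 0 = 1)) true).toReal := by
    simp only [detects, accepts, realView, PMF.bind_bind, PMF.bind_map, PMF.map_bind]
    rfl
  rw [h1]
  unfold CKKS.acceptance
  rw [PMF.bind_comm]
  exact abs_toReal_sub_le (PMF.apply_ne_top _ _) (PMF.apply_ne_top _ _) (PMF.apply_ne_top _ _)
    (bind_apply_le_add _ fun k => (h k).1) (bind_apply_le_add _ fun k => (h k).2)

/-- The simulated view is the view in which all plaintexts are blanked. -/
lemma detects_simView {P : Params} (x : Input P) (D : Prog) {T : ℕ}
    (hT : ∀ τ ∈ (trace x (pragII P) []).support, Transcript.size τ ≤ T) :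
    detects P D (simView P (simulator T) x) = ((trace x (pragII P) []).bind
      (fun τ => P.acceptance D P.publicWords (Transcript.blank τ)) true).toReal := by
  have hL : leakage P x = (trace x (pragII P) []).map fun τ =>
      ⟨P.size, P.dim, P.clusters, P.topK, τ.map Prod.fst⟩ := by
    have := congrArg (PMF.map fun es => Leakage.mk P.size P.dim P.clusters P.topK es)
      (trace_map_fst x (pragII P) [])
    rw [PMF.map_comp, PMF.map_comp] at this
    exact this.symm
  simp only [detects, accepts, simView, hL, PMF.bind_map, PMF.bind_bind, PMF.map_bind]
  congr 2
  refine bind_congr_of_support _ fun τ hτ => ?_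
  rw [Function.comp_apply, P.exec_simulator ⟨P.size, P.dim, P.clusters, P.topK, τ.map Prod.fst⟩ T
    (hT τ hτ)]
  unfold CKKS.acceptance
  simp only [PMF.bind_bind, PMF.bind_map, Transcript.blank, List.map_map,
    Function.comp_def]
  rfl

lemma length_publicWords {P : Params} (τ : Transcript P.N) :
    (P.publicWords (τ.map Prod.fst)).length = 4 + 3 * Transcript.size τ := by
  rw [Params.publicWords, Leakage.words_eq, List.length_append, length_words]
  rfl

/-- The bit length that suffices for all numbers in the adversary. -/
def wordBound (M : ℕ) : ℕ := 4 * pragCost M + 2 * M + 10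

/-- Every possible transcript is short, and a distinguisher between it and its blanked version has at
most the advantage of IND-CPA adversaries of polynomial size, times the number of events. -/
lemma acceptance_blank_near {P : Params} (x : Input P) (D : Prog) {ε : ℝ} (hε : 0 ≤ ε) {M : ℕ}
    (hM : M = P.complexity)
    (hsec : ∀ A B : Prog,
      cost A ≤ CKKS.adversaryBound M (pragCost M) (4 + 3 * pragCost M) (wordBound M) (cost D) →
      cost B ≤ CKKS.adversaryBound M (pragCost M) (4 + 3 * pragCost M) (wordBound M) (cost D) →
      |cpaGame P.toCKKS A B false - cpaGame P.toCKKS A B true| ≤ ε)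
    {τ : Transcript P.N} (hτ : τ ∈ (trace x (pragII P) []).support) :
    Transcript.size τ ≤ pragCost M ∧
    |(P.acceptance D P.publicWords τ true).toReal -
      (P.acceptance D P.publicWords (Transcript.blank τ) true).toReal| ≤ pragCost M * ε := by
  have hN : P.N ≤ M := by rw [hM]; unfold Params.complexity; omega
  have hP : P.AtMost M := hM ▸ P.atMost_complexity
  have hq : Nat.size (P.modulus P.depth) ≤ M := by
    refine (Nat.size_le_size (Nat.le_mul_of_pos_left _ P.special_pos)).trans ?_
    rw [hM]; unfold Params.complexity; omega
  have hM1 : 1 ≤ M := le_trans (by have := P.two_le_N; omega) hN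
  obtain ⟨hsize, hwords⟩ := (bounded_pragII (B := M + pragCost M) hP (by omega) hM1).trace_spec x []
    (by simp) τ hτ
  have hlen : τ.length ≤ pragCost M := (Transcript.length_le_size τ).trans hsize
  refine ⟨hsize, ?_⟩
  have hdim : P.dim ≤ M := by
    refine P.dim_le.trans (le_trans ?_ hN)
    exact Nat.pow_le_pow_right (by norm_num) (Nat.le_succ _)
  have hw : ∀ k, k ≤ M → Nat.size k ≤ wordBound M := fun k hk =>
    (size_le_self k).trans (by unfold wordBound; omega)
  have hwords' : ∀ e ∈ τ, ∀ v ∈ e.1.words, Nat.size v ≤ wordBound M := fun e he v hv =>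
    (hwords e he v hv).trans (by unfold wordBound; omega)
  have hpub : ∀ v ∈ P.publicWords (τ.map Prod.fst), Nat.size v ≤ wordBound M := by
    intro v hv
    simp only [Params.publicWords, Leakage.words, List.mem_append, List.mem_cons, List.mem_flatMap,
      List.mem_map, List.not_mem_nil, or_false] at hv
    rcases hv with (rfl | rfl | rfl | rfl) | ⟨_, ⟨e, he, rfl⟩, hv⟩
    · exact hw _ hP.size
    · exact hw _ hdim
    · exact hw _ hP.clusters
    · exact hw _ hP.topK
    · exact hwords' e he v hv
  have hmono : CKKS.adversaryBound P.N (pragCost M) (4 + 3 * pragCost M) (wordBound M) (cost D) ≤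
      CKKS.adversaryBound M (pragCost M) (4 + 3 * pragCost M) (wordBound M) (cost D) := by
    unfold CKKS.adversaryBound
    gcongr
  have hqw : Nat.size (P.modulus P.depth) ≤ wordBound M := hq.trans (by unfold wordBound; omega)
  have key := P.acceptance_sub_blank_le D P.publicWords hε hsec [] τ ?_
  · refine key.trans (mul_le_mul_of_nonneg_right ?_ hε)
    exact_mod_cast hlen
  · intro σ' τ' m h
    rw [List.nil_append] at h ⊢
    have hl := congrArg List.length h
    simp only [List.length_map, List.length_append, List.length_cons] at hl
    have hmem : ∀ e ∈ σ' ++ (Event.fresh, m) :: τ', ∀ v ∈ e.1.words, Nat.size v ≤ wordBound M := by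
      intro e he v hv
      have : e.1 ∈ τ.map Prod.fst := h ▸ List.mem_map_of_mem he
      obtain ⟨e', he', h'⟩ := List.mem_map.1 this
      exact hwords' e' he' v (h' ▸ hv)
    constructor
    · exact (P.cost_challengeProg_le σ' τ' m hqw (by omega) (by unfold wordBound; omega)
        fun e he => hmem e (by simp [he])).trans hmono
    · exact (P.cost_guessProg_le σ' τ' _ D hqw (by omega) (by unfold wordBound; omega)
        (fun e he => hmem e (by simp [he]))
        (by rw [length_publicWords]; omega) (by unfold wordBound; omega) hpub).trans hmono

end PRAG

end

theorem theorem2 (P : ℕ → PRAG.Params)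
    (hP : PRAG.PolyBounded fun s => (P s).complexity)
    (hCPA : PRAG.INDCPA fun s => (P s).toCKKS) :
    PRAG.SemanticConfidentiality P (PRAG.ExactOrderings P) := by
  open PRAG in
  have hT := hP.pragCost
  refine ⟨fun s => simulator (pragCost (P s).complexity), ?_, fun x hx D hD => ?_⟩
  · exact ((PolyBounded.const 1).add (hT.mul ((PolyBounded.const 27).mul ((PolyBounded.const 1).add
      (((PolyBounded.const 3).mul hT).add (PolyBounded.const 14)))))).mono
        fun s => cost_simulator_le _
  have hW : PolyBounded fun s => wordBound (P s).complexity :=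
    (((PolyBounded.const 4).mul hT).add ((PolyBounded.const 2).mul hP)).add (PolyBounded.const 10)
  have hb : PolyBounded fun s => CKKS.adversaryBound (P s).complexity (pragCost (P s).complexity)
      (4 + 3 * pragCost (P s).complexity) (wordBound (P s).complexity) (cost (D s)) :=
    ((hT.mul ((hP.add (.const 5)).mul ((PolyBounded.const 1).add hW))).add
      (((((PolyBounded.const 4).add ((PolyBounded.const 3).mul hT)).add
        ((PolyBounded.const 4).mul hP)).add (.const 20)).mul ((PolyBounded.const 1).add hW))).add hD
  obtain ⟨ε, hε, hε0, hsec⟩ := INDCPA.exists_negligible_bound hCPA hb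
  refine Negligible.of_abs_le (Negligible.add hx (Negligible.poly_mul hT hε)) fun s => ?_
  have hnear := fun τ hτ => acceptance_blank_near (x s) (D s) (hε0 s) rfl (hsec s) (τ := τ) hτ
  have h1 := detects_realView_near (x s) (D s)
  rw [detects_simView (x s) (D s) fun τ hτ => (hnear τ hτ).1]
  have hδ : 0 ≤ (pragCost (P s).complexity : ℝ) * ε s := mul_nonneg (Nat.cast_nonneg _) (hε0 s)
  have h2 : |((trace (x s) (pragII (P s)) []).bind
        ((P s).acceptance (D s) (P s).publicWords) true).toReal -
      ((trace (x s) (pragII (P s)) []).bind (fun τ =>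
        (P s).acceptance (D s) (P s).publicWords (Transcript.blank τ)) true).toReal| ≤
      pragCost (P s).complexity * ε s := by
    refine (abs_toReal_sub_le (PMF.apply_ne_top _ _) (PMF.apply_ne_top _ _) ENNReal.ofReal_ne_top
      (bind_apply_le_add_const _ _ fun τ hτ => ?_)
      (bind_apply_le_add_const _ _ fun τ hτ => ?_)).trans_eq (ENNReal.toReal_ofReal hδ)
    · exact le_add_of_abs_toReal_sub_le (PMF.apply_ne_top _ _) (PMF.apply_ne_top _ _) (hnear τ hτ).2
    · refine le_add_of_abs_toReal_sub_le (PMF.apply_ne_top _ _) (PMF.apply_ne_top _ _) ?_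
      rw [abs_sub_comm]
      exact (hnear τ hτ).2
  rw [abs_abs, abs_of_nonneg (add_nonneg ENNReal.toReal_nonneg hδ)]
  exact (abs_sub_le _ _ _).trans (add_le_add h1 h2)
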